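/- Let $\mathbb{R}^p$ carry an inner product $\langle\cdot,\cdot\rangle$ with norm $\|\cdot\|$, and let $G:\mathbb{R}^p\to\mathbb{R}^p$ satisfy $\operatorname{zer}(G):=\{x : Gx=0\}\neq\emptyset$. Assume that there are $\beta,\bar\beta\ge 0$ and $\mathcal D:\mathbb{R}^p\times\mathbb{R}^p\to[0,\infty)$ with $\mathcal D(x,x)=0$ such that $$\langle Gx-Gy,x-y\rangle\ \ge\ \beta\|Gx-Gy\|^2+\bar\beta\,\mathcal D(x,y)\qquad\text{for all }x,y .$$ Let $\gamma\in(0,1]$, $s>1$ with $s\ge 1+3\gamma$, let $\tau\ge 1$ be an integer and, with a number $\eta>0$ to be restricted below, put $$t_k:=k+3s+\tau,\qquad \eta_k:=\frac{\eta\,t_k}{2(t_k-s)}\qquad(k\ge 0).$$ On a probability space with a filtration $(\mathcal F_k)_{k\ge0}$, starting from a deterministic $y^0=z^0\in\mathbb{R}^p$, let $$x^{k+1}=y^k-\eta_k\widetilde G^k,\qquad z^{k+1}=z^k+\tfrac{\gamma}{s}(x^{k+1}-y^k),\qquad y^{k+1}=\tfrac{t_k-s}{t_k}x^{k+1}+\tfrac{s}{t_k}z^{k+1}\qquad(k\ge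 0),$$ where $\widetilde G^k$ is a random estimator of $Gy^k$ and $x^k$ is $\mathcal F_k$-measurable for every $k\ge 0$ ($x^0$ does not enter the scheme and may be chosen arbitrarily, e.g. $x^0=y^0$). Write $e^k:=\widetilde G^k-Gy^k$ and $\mathbb E_k[\cdot]:=\mathbb E[\cdot\mid\mathcal F_k]$. Assume that there are constants $\kappa\in(0,1]$, $\Theta,\hat\Theta\ge0$ (with $\Theta=0$ if $\beta=0$, and $\hat\Theta=0$ if $\bar\beta=0$), nonnegative random variables $\Delta_k$ ($k\ge0$), integer delays $0\le\tau_k\le\tau$ and numbers $\delta_k\ge0$ such that, almost surely, for all $k\ge0$, $$\mathbb E_k\|e^k\|^2\le\mathbb E_k\Delta_k,\qquad \mathbb E_k\Delta_k\le(1-\kappa)\Delta_{k-1}+\sum_{l=\max\{k-\tau_k+1,0\}}^{k}\Big[\Theta\|Gy^l-Gy^{l-1}\|^2+\hat\Theta\,\mathcal D(y^l,y^{l-1})\Big]+\frac{\delta_k}{t_k(t_k-s)},$$ with the conventions $y^{-1}:=y^0$ and $\Delta_{-1}:=0$. Put $\Lambda:=1+s-\gamma$, $\alpha:=\frac{2s+1}{(s+1)^2}$,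 $\theta:=1-(1-\kappa)\alpha$, assume $\kappa>\alpha$ and $\Theta\bar\beta\le\hat\Theta\beta$, and let $0<\eta\le\bar\eta$, where $$\bar\eta:=\begin{cases}\dfrac{3\theta\bar\beta}{7\Lambda\hat\Theta}&\text{if }0<\bar\beta\le\dfrac{7\Lambda\hat\Theta\beta}{7\Lambda\Theta+3\theta(1+\tau)},\\[2ex]\dfrac{3\theta\beta}{7\Lambda\Theta+3\theta(1+\tau)}&\text{otherwise.}\end{cases}$$ If $\sum_{k\ge0}\delta_k<\infty$, then almost surely $$\sum_{k=0}^\infty(k+\tau)\|Gy^k\|^2<\infty,\qquad\sum_{k=0}^\infty(k+\tau)\|x^{k+1}-x^k\|^2<\infty,$$ $$\lim_{k\to\infty}(k+\tau)^2\|Gy^k\|^2=0,\qquad\lim_{k\to\infty}(k+\tau)^2\|x^{k+1}-x^k\|^2=0,$$ and there is a $\operatorname{zer}(G)$-valued random variable $x^\star$ such that $x^k\to x^\star$, $y^k\to x^\star$ and $z^k\to x^\star$ almost surely. -/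

import Mathlib

open Filter Topology MeasureTheory
open scoped ENNReal

namespace AFP

section Problem

variable {E : Type*} [NormedAddCommGroup E] [InnerProductSpace ℝ E]

/-- The solution set `zer G = {x | G x = 0}`. -/
def zer (G : E → E) : Set E := {x | G x = 0}

/-- The generalized co-coercivity condition
`⟪G x - G y, x - y⟫ ≥ β ‖G x - G y‖² + β' D(x, y)` for all `x, y`, where `β, β' ≥ 0` and `D` is a
nonnegative function that vanishes on the diagonal. -/
structure GenCocoercive (G : E → E) (β β' : ℝ) (D : E → E → ℝ) : Prop where
  beta_nonneg : 0 ≤ β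
  beta'_nonneg : 0 ≤ β'
  D_nonneg : ∀ x y, 0 ≤ D x y
  D_self : ∀ x, D x x = 0
  ineq : ∀ x y, β * ‖G x - G y‖ ^ 2 + β' * D x y ≤ inner ℝ (G x - G y) (x - y)

/-- The sequences `x, y, z` are generated by the accelerated fixed-point scheme with constant `s`,
parameter sequences `t, γ, η`, initial point `y0` and estimators `g k` (of `G (y k)`):
`y⁰ = z⁰ = y0` and, for `k ≥ 0`,
`xᵏ⁺¹ = yᵏ - ηₖ gᵏ`, `zᵏ⁺¹ = zᵏ + (γₖ / s) (xᵏ⁺¹ - yᵏ)`,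
`yᵏ⁺¹ = ((tₖ - s) / tₖ) xᵏ⁺¹ + (s / tₖ) zᵏ⁺¹`.
The point `x⁰` does not enter the scheme, and is left arbitrary. -/
structure IsTrajectory (s : ℝ) (t γ η : ℕ → ℝ) (y0 : E) (g x y z : ℕ → E) : Prop where
  y_zero : y 0 = y0
  z_zero : z 0 = y0
  x_succ : ∀ k, x (k + 1) = y k - η k • g k
  z_succ : ∀ k, z (k + 1) = z k + (γ k / s) • (x (k + 1) - y k)
  y_succ : ∀ k, y (k + 1) = ((t k - s) / t k) • x (k + 1) + (s / t k) • z (k + 1)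

end Problem

section Parameters

/-- `tₖ = k + 3 s + τ`. -/
noncomputable def tSeq (s : ℝ) (τ : ℕ) (k : ℕ) : ℝ := (k : ℝ) + 3 * s + (τ : ℝ)

/-- `ηₖ = η tₖ / (2 (tₖ - s))`. -/
noncomputable def etaSeq (η s : ℝ) (τ : ℕ) (k : ℕ) : ℝ :=
  η * tSeq s τ k / (2 * (tSeq s τ k - s))

/-- `Λ = 1 + s - γ`. -/
noncomputable def lam (s γ : ℝ) : ℝ := 1 + s - γ

/-- `α = (2 s + 1) / (s + 1)²`. -/
noncomputable def alpha (s : ℝ) : ℝ := (2 * s + 1) / (s + 1) ^ 2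

/-- `θ = 1 - (1 - κ) α`. -/
noncomputable def theta (κ s : ℝ) : ℝ := 1 - (1 - κ) * alpha s

/-- The largest admissible step size. The second branch is meant for `β' = 0` or
`7 Λ Θ' β / (7 Λ Θ + 3 θ (1 + τ)) ≤ β' ≤ (Θ' / Θ) β`; under `Θ β' ≤ Θ' β` (the upper bound, cleared
of denominators) these are exactly the cases outside the first branch, together with the common
boundary point, where both formulas agree. -/
noncomputable def etaBar (β β' Θ Θ' κ s γ : ℝ) (τ : ℕ) : ℝ :=
  open Classical in
  if 0 < β' ∧
      β' ≤ 7 * lam s γ * Θ' * β / (7 * lam s γ * Θ + 3 * theta κ s * (1 + (τ : ℝ))) then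
    3 * theta κ s * β' / (7 * lam s γ * Θ')
  else
    3 * theta κ s * β / (7 * lam s γ * Θ + 3 * theta κ s * (1 + (τ : ℝ)))

end Parameters

section Error

variable {E : Type*} [NormedAddCommGroup E] [InnerProductSpace ℝ E]
variable {Ω : Type*} {mΩ : MeasurableSpace Ω}

/-- The sequence `k ↦ Δₖ₋₁`, with the convention `Δ₋₁ = 0`. -/
def prev (Δ : ℕ → Ω → ℝ) : ℕ → Ω → ℝ
  | 0 => fun _ => 0
  | k + 1 => Δ k

/-- The error approximation condition for the estimators `g k` of `G (y k)`, with error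
`eᵏ = gᵏ - G yᵏ`. Almost surely, for all `k`,
`𝔼ₖ ‖eᵏ‖² ≤ 𝔼ₖ Δₖ` and
`𝔼ₖ Δₖ ≤ (1 - κ) Δₖ₋₁ + ∑_{l = [k - τₖ + 1]₊}^k (Θ ‖G yˡ - G yˡ⁻¹‖² + Θ' D(yˡ, yˡ⁻¹))`
`+ δₖ / (tₖ (tₖ - s))`,
where `𝔼ₖ` is the conditional expectation given `ℱ k`, taken in `[0, ∞]` because no integrability
is presupposed. Truncated subtraction of natural numbers gives the positive part in the lower
summation bound and the convention `y⁻¹ = y⁰`. The delay `τₖ` is called `d k`; it may be random. -/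
structure ErrorCondition (P : Measure Ω) (ℱ : Filtration ℕ mΩ) (G : E → E) (D : E → E → ℝ)
    (β β' s : ℝ) (t : ℕ → ℝ) (τ : ℕ) (g y : ℕ → Ω → E)
    (κ Θ Θ' : ℝ) (d : ℕ → Ω → ℕ) (Δ : ℕ → Ω → ℝ) (δ : ℕ → ℝ) : Prop where
  kappa_pos : 0 < κ
  kappa_le_one : κ ≤ 1
  Theta_nonneg : 0 ≤ Θ
  Theta'_nonneg : 0 ≤ Θ'
  Theta_eq_zero : β = 0 → Θ = 0
  Theta'_eq_zero : β' = 0 → Θ' = 0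
  delay_le : ∀ k ω, d k ω ≤ τ
  Delta_measurable : ∀ k, Measurable (Δ k)
  Delta_nonneg : ∀ k ω, 0 ≤ Δ k ω
  delta_nonneg : ∀ k, 0 ≤ δ k
  error_le : ∀ k, ∀ᵐ ω ∂P,
    condLExp (ℱ k) P (fun ω' => ENNReal.ofReal (‖g k ω' - G (y k ω')‖ ^ 2)) ω
      ≤ condLExp (ℱ k) P (fun ω' => ENNReal.ofReal (Δ k ω')) ω
  Delta_le : ∀ k, ∀ᵐ ω ∂P,
    condLExp (ℱ k) P (fun ω' => ENNReal.ofReal (Δ k ω')) ω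
      ≤ ENNReal.ofReal
          ((1 - κ) * prev Δ k ω
            + ∑ l ∈ Finset.Icc (k + 1 - d k ω) k,
                (Θ * ‖G (y l ω) - G (y (l - 1) ω)‖ ^ 2 + Θ' * D (y l ω) (y (l - 1) ω))
            + δ k / (t k * (t k - s)))

end Error

end AFP

/-! For a zero `p`, the energy `η/4 a² ‖Gy‖² - a s ⟪Gy, z - y⟫ + s²(s-1)/(γη) ‖z - p‖²`, taken at `a
= t_k - 1`, obeys an exact one-step identity. Co-coercivity turns it into a decrease by terms of
order `t ‖Gy‖²` and `t² ‖Gy⁺ - Gy‖²`, up to a factor `1 + C/t²` and an error of order `t² ‖e‖²`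
(`exists_energy_succ_le`).

The errors are in turn controlled by these same decrements: the contraction `1 - κ` beats the growth
of the weights, so the weighted sum of expected errors is at most a constant times the weighted sum
of delayed increments (`sum_weighted_le_of_delayed_contraction`). The step size keeps the product of
the two constants at most `13/14`. Inserting one summed estimate into the other therefore closes the
loop, with Grönwall taking care of `1 + C/t²` (`summable_weighted_errors`). Hence `∑ t_k² ‖e^k‖²` is
finite almost surely (`ae_summable_errors`).

From there no martingale argument is needed: each such path is deterministic (`ControlledRun`).
Robbins–Siegmund gives the first summability claims and the convergence of the energy. The
difference `z - y` is repeatedly averaged with a small forcing, so it vanishes. The part of the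
energy free of `p` has summable increments, so it converges by itself; its cross term vanishes, so
`a² ‖Gy‖²` converges, and the limit is zero because `∑ t ‖Gy‖²` is finite. What remains of the
energy says that `‖z - p‖` converges for every zero `p`, and Opial's argument in finite dimension
concludes. -/

namespace AFP

/-! ### Real sequences: summable recursions and delayed contractions. -/

section Sequences

open Finset in
/-- Grönwall's inequality with a summable kernel, in summed form. -/
theorem le_mul_exp_tsum_of_le_add_sum {X a : ℕ → ℝ} {A : ℝ} (hA : 0 ≤ A) (ha : ∀ k, 0 ≤ a k)
    (hs : Summable a) (h : ∀ n, X n ≤ A + ∑ k ∈ range n, a k * X k) (n : ℕ) :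
    X n ≤ A * Real.exp (∑' k, a k) := by
  -- It is the right-hand side, which dominates `X`, that satisfies the one-step recursion with
  -- factor `1 + a n`.
  have key := discrete_gronwall (u := fun n => A + ∑ k ∈ range n, a k * X k) (b := 0) (c := a)
    (n₀ := 0) (by simpa using hA)
    (fun n _ => by
      have := mul_le_mul_of_nonneg_left (h n) (ha n)
      simp only [sum_range_succ, Pi.zero_apply]
      linarith)
    (fun n _ => ha n) (fun n _ => le_rfl) (Nat.zero_le n)
  refine (h n).trans (key.trans ?_)
  simp only [range_zero, sum_empty, add_zero, Pi.zero_apply, sum_const_zero]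
  gcongr
  exact hs.sum_le_tsum _ (fun i _ => ha i)

open Finset in
/-- A sequence that is bounded below and whose increments are bounded by a summable sequence
converges. -/
theorem exists_tendsto_of_le_add {X b : ℕ → ℝ} {m : ℝ} (hX : ∀ k, m ≤ X k) (hb : Summable b)
    (h : ∀ k, X (k + 1) ≤ X k + b k) : ∃ l, Tendsto X atTop (𝓝 l) := by
  have hanti : Antitone (fun n => X n - ∑ k ∈ range n, b k) := by
    refine antitone_nat_of_succ_le fun n => ?_
    rw [sum_range_succ]
    linarith [h n]
  have hlim := hb.hasSum.tendsto_sum_nat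
  obtain ⟨M, hM⟩ := hlim.bddAbove_range
  have hbdd : BddBelow (Set.range (fun n => X n - ∑ k ∈ range n, b k)) := by
    refine ⟨m - M, ?_⟩
    rintro _ ⟨n, rfl⟩
    have : ∑ k ∈ range n, b k ≤ M := hM ⟨n, rfl⟩
    simp only
    linarith [hX n]
  refine ⟨_, ((tendsto_atTop_ciInf hanti hbdd).add hlim).congr fun n => by ring⟩

open Finset in
/-- The deterministic Robbins–Siegmund lemma. -/
theorem summable_and_tendsto_of_le {X A a b : ℕ → ℝ} (hX : ∀ k, 0 ≤ X k) (hA : ∀ k, 0 ≤ A k)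
    (ha : ∀ k, 0 ≤ a k) (hb : ∀ k, 0 ≤ b k) (hsa : Summable a) (hsb : Summable b)
    (h : ∀ k, X (k + 1) ≤ (1 + a k) * X k - A k + b k) :
    Summable A ∧ ∃ l, Tendsto X atTop (𝓝 l) := by
  have hsum : ∀ n, X n + ∑ k ∈ range n, A k
      ≤ X 0 + ∑ k ∈ range n, b k + ∑ k ∈ range n, a k * X k := by
    intro n
    induction n with
    | zero => simp
    | succ n ih =>
      simp only [sum_range_succ]
      linarith [h n]
  have hbs : ∀ n, ∑ k ∈ range n, b k ≤ ∑' k, b k := fun n => hsb.sum_le_tsum _ (fun i _ => hb i)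
  have hbd := le_mul_exp_tsum_of_le_add_sum (X := X) (A := X 0 + ∑' k, b k)
    (add_nonneg (hX 0) (tsum_nonneg hb)) ha hsa
    (fun n => by
      have h1 := hsum n
      have h2 := hbs n
      have h3 : 0 ≤ ∑ k ∈ range n, A k := sum_nonneg fun k _ => hA k
      linarith)
  set M := (X 0 + ∑' k, b k) * Real.exp (∑' k, a k)
  have haX : ∀ k, a k * X k ≤ a k * M := fun k => mul_le_mul_of_nonneg_left (hbd k) (ha k)
  have hsaX : Summable fun k => a k * X k :=
    (hsa.mul_right M).of_nonneg_of_le (fun k => mul_nonneg (ha k) (hX k)) haX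
  refine ⟨summable_of_sum_range_le hA (c := X 0 + ∑' k, b k + ∑' k, a k * X k) fun n => ?_, ?_⟩
  · have h1 := hsum n
    have h2 := hbs n
    have h3 := hsaX.sum_le_tsum (range n) (fun i _ => mul_nonneg (ha i) (hX i))
    linarith [hX n]
  · refine exists_tendsto_of_le_add hX (hsaX.add hsb) fun k => ?_
    have := h k
    have := hA k
    linarith

/-- A convergent sequence that is summable against `1 / (k + c)` tends to zero. -/
theorem tendsto_zero_of_summable_div {u : ℕ → ℝ} {c l : ℝ} (hc : 0 < c) (hu : ∀ k, 0 ≤ u k)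
    (hl : Tendsto u atTop (𝓝 l)) (hs : Summable fun k : ℕ => u k / ((k : ℝ) + c)) :
    Tendsto u atTop (𝓝 0) := by
  have hl0 : 0 ≤ l := ge_of_tendsto' hl hu
  rcases hl0.eq_or_lt with h0 | hpos
  · rwa [← h0] at hl
  exfalso
  have hev : ∀ᶠ k in atTop, l / 2 < u k := hl.eventually (lt_mem_nhds (by linarith))
  obtain ⟨N, hN⟩ := eventually_atTop.1 hev
  have hs' := (summable_nat_add_iff N).2 hs
  -- Beyond `N` the sequence exceeds `l / 2`; with `n > c + N` the shifted terms dominate a multiple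
  -- of `1 / (k + n)`, a harmonic tail.
  obtain ⟨n, hn⟩ := exists_nat_gt (c + N)
  have hn0 : (0 : ℝ) < n := by
    have : (0 : ℝ) ≤ N := N.cast_nonneg
    linarith
  have : Summable fun k : ℕ => ((k + n : ℕ) : ℝ)⁻¹ := by
    refine (hs'.mul_left (2 / l)).of_nonneg_of_le (fun k => by positivity) fun k => ?_
    have hk : (0 : ℝ) < ((k + N : ℕ) : ℝ) + c := by positivity
    rw [← mul_div_assoc, inv_eq_one_div]
    have h1 : 1 ≤ 2 / l * u (k + N) := by
      rw [div_mul_eq_mul_div, le_div_iff₀ hpos]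
      linarith [hN (k + N) (by omega)]
    refine div_le_div₀ (by linarith) h1 hk ?_
    push_cast
    linarith
  exact Real.not_summable_natCast_inv ((summable_nat_add_iff n).1 this)

open Finset in
/-- Summing over windows of length `τ` counts each term at most `τ` times. -/
theorem sum_window_le {w : ℕ → ℝ} (hw : ∀ l, 0 ≤ w l) (τ n : ℕ) :
    ∑ k ∈ range n, ∑ l ∈ Icc (k + 1 - τ) k, w l ≤ τ * ∑ l ∈ range n, w l := by
  have h1 : ∑ k ∈ range n, ∑ l ∈ Icc (k + 1 - τ) k, w l
      = ∑ l ∈ range n, ∑ k ∈ (range n).filter (fun k => l ∈ Icc (k + 1 - τ) k), w l := by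
    refine sum_comm' fun k l => ?_
    simp only [mem_range, mem_Icc, mem_filter]
    omega
  rw [h1, mul_sum]
  refine sum_le_sum fun l _ => ?_
  rw [sum_const, nsmul_eq_mul]
  refine mul_le_mul_of_nonneg_right ?_ (hw l)
  have : (range n).filter (fun k => l ∈ Icc (k + 1 - τ) k) ⊆ Ico l (l + τ) := by
    intro k
    simp only [mem_range, mem_Icc, mem_filter, mem_Ico]
    omega
  exact_mod_cast (card_le_card this).trans (by simp)

open Finset in
/-- A weighted sum of a sequence that contracts up to delayed perturbations. -/
theorem sum_weighted_le_of_delayed_contraction {W D σ δ : ℕ → ℝ} {κ : ℝ} {τ : ℕ} (hκ : 0 < κ)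
    (hκ1 : κ ≤ 1) (hW : ∀ k, 0 < W k) (hD : ∀ k, 0 ≤ D k) (hσ : ∀ k, 0 ≤ σ k) (hσ0 : σ 0 = 0)
    (hWκ : ∀ k, (1 - κ) * W (k + 1) ≤ (1 - κ / 2) * W k)
    (hWτ : ∀ l j, j < τ → W (l + 1 + j) ≤ 4 * W l)
    (h0 : D 0 ≤ ∑ l ∈ Icc (0 + 1 - τ) 0, σ l + δ 0 / W 0)
    (h : ∀ k, D (k + 1) ≤ (1 - κ) * D k + ∑ l ∈ Icc (k + 1 + 1 - τ) (k + 1), σ l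
      + δ (k + 1) / W (k + 1)) (n : ℕ) :
    ∑ k ∈ range (n + 1), W k * D k
      ≤ 8 * τ / κ * ∑ k ∈ range n, W k * σ (k + 1) + 2 / κ * ∑ k ∈ range (n + 1), δ k := by
  -- The weight is shifted because `σ l` will measure the increment from `l - 1` to `l`. At `l = 0`
  -- the truncated index is harmless, as `σ 0 = 0`.
  set w : ℕ → ℝ := fun l => W (l - 1) * σ l with hw
  have hw0 : ∀ l, 0 ≤ w l := fun l => mul_nonneg (hW _).le (hσ _)
  have hwin : ∀ k, W k * ∑ l ∈ Icc (k + 1 - τ) k, σ l ≤ 4 * ∑ l ∈ Icc (k + 1 - τ) k, w l := by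
    intro k
    rw [mul_sum, mul_sum]
    refine sum_le_sum fun l hl => ?_
    rw [mem_Icc] at hl
    rcases l with _ | l
    · simp [hw, hσ0]
    · have := hWτ l (k - (l + 1)) (by omega)
      rw [show l + 1 + (k - (l + 1)) = k by omega] at this
      simp only [hw, Nat.add_sub_cancel, ← mul_assoc]
      exact mul_le_mul_of_nonneg_right this (hσ _)
  have hdiv : ∀ k, W k * (δ k / W k) = δ k := fun k => mul_div_cancel₀ _ (hW k).ne'
  have hstep : ∑ k ∈ range (n + 1), W k * D k
      ≤ (1 - κ / 2) * ∑ k ∈ range n, W k * D k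
        + 4 * ∑ k ∈ range (n + 1), ∑ l ∈ Icc (k + 1 - τ) k, w l + ∑ k ∈ range (n + 1), δ k := by
    induction n with
    | zero =>
      have h1 := mul_le_mul_of_nonneg_left h0 (hW 0).le
      rw [mul_add, hdiv] at h1
      simp only [range_zero, sum_empty, mul_zero, zero_add, range_one, sum_singleton]
      linarith [hwin 0]
    | succ n ih =>
      have h1 := mul_le_mul_of_nonneg_left (h n) (hW (n + 1)).le
      rw [mul_add, mul_add, hdiv] at h1
      have h2 := mul_le_mul_of_nonneg_right (hWκ n) (hD n)
      rw [sum_range_succ _ (n + 1), sum_range_succ (fun k => ∑ l ∈ Icc (k + 1 - τ) k, w l) (n + 1),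
        sum_range_succ δ (n + 1)]
      rw [sum_range_succ _ n, mul_add (1 - κ / 2)]
      rw [sum_range_succ _ n] at ih
      linarith [hwin (n + 1)]
  have hWD : ∀ k, 0 ≤ W k * D k := fun k => mul_nonneg (hW k).le (hD k)
  have hwsum : ∑ l ∈ range (n + 1), w l = ∑ k ∈ range n, W k * σ (k + 1) := by
    rw [sum_range_succ']
    simp [hw, hσ0]
  have hwindow := sum_window_le hw0 τ (n + 1)
  rw [hwsum] at hwindow
  set S := ∑ k ∈ range (n + 1), W k * D k
  -- The growth of the weights uses half of the contraction; absorbing the sum with factor `1 - κ /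
  -- 2` leaves `κ / 2` on the left.
  have hS : κ / 2 * S ≤ 4 * (τ * ∑ k ∈ range n, W k * σ (k + 1)) + ∑ k ∈ range (n + 1), δ k := by
    have : ∑ k ∈ range n, W k * D k ≤ S := by
      simp only [S, sum_range_succ _ n]
      linarith [hWD n]
    have := mul_le_mul_of_nonneg_left this (show 0 ≤ 1 - κ / 2 by linarith)
    linarith
  have : S = 2 / κ * (κ / 2 * S) := by field_simp
  rw [this]
  calc 2 / κ * (κ / 2 * S)
      ≤ 2 / κ * (4 * (τ * ∑ k ∈ range n, W k * σ (k + 1)) + ∑ k ∈ range (n + 1), δ k) :=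
        mul_le_mul_of_nonneg_left hS (by positivity)
    _ = _ := by ring

end Sequences

/-! ### One-step identities and estimates for the energy. -/

section Energy

variable {E : Type*} [NormedAddCommGroup E] [InnerProductSpace ℝ E]

/-- The part of the energy that does not depend on a solution, at weight `a`. -/
noncomputable def gap (s η a : ℝ) (Gy y z : E) : ℝ :=
  η / 4 * a ^ 2 * ‖Gy‖ ^ 2 - a * s * inner ℝ Gy (z - y)

/-- The energy of the scheme relative to the point `p`, at weight `a`. -/
noncomputable def energy (s γ η a : ℝ) (p Gy y z : E) : ℝ :=
  gap s η a Gy y z + s ^ 2 * (s - 1) / (γ * η) * ‖z - p‖ ^ 2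

/-- The exact change of the gap in one step of the scheme. -/
theorem gap_succ {s γ η t h : ℝ} (ht : t ≠ 0) (hts : t - s ≠ 0) (hs : s ≠ 0)
    (hh : h = η * t / (2 * (t - s))) {Gy Gy' e y z x' y' z' : E}
    (hx : x' = y - h • (Gy + e)) (hz : z' = z + (γ / s) • (x' - y))
    (hy : y' = ((t - s) / t) • x' + (s / t) • z') :
    gap s η t Gy' y' z' - gap s η (t - 1) Gy y z
      = - (t * (t - s)) * inner ℝ (Gy' - Gy) (y' - y) + η / 4 * t ^ 2 * ‖Gy' - Gy‖ ^ 2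
        - η / 4 * (2 * t * (s - γ - 1) + 1) * ‖Gy‖ ^ 2
        + s * (s - 1) * inner ℝ Gy (z - y)
        - η / 2 * t ^ 2 * inner ℝ (Gy' - Gy) e - η * t / 2 * (s - γ) * inner ℝ Gy e := by
  -- In terms of `w = z - y` and `Gy + e` both new differences are linear combinations, so the claim
  -- becomes an identity between inner products.
  obtain ⟨w, rfl⟩ : ∃ w, z = y + w := ⟨z - y, by abel⟩
  have hy1 : y' - y = (s / t) • w - ((t - s + γ) * h / t) • (Gy + e) := by
    rw [hy, hz, hx]
    match_scalars <;> field_simp <;> ring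
  have hy2 : z' - y' = ((t - s) / t) • w + ((t - s) / t * (h * (1 - γ / s))) • (Gy + e) := by
    rw [hy, hz, hx]
    match_scalars <;> field_simp <;> ring
  rw [gap, gap, hy1, hy2, add_sub_cancel_left]
  simp only [inner_sub_left, inner_add_right, inner_sub_right, inner_smul_right,
    ← real_inner_self_eq_norm_sq]
  rw [real_inner_comm Gy Gy', hh]
  field_simp
  ring

/-- The change of the distance of `z` to a point in one step of the scheme. -/
theorem sq_dist_succ {s γ η t h : ℝ} (hts : t - s ≠ 0) (hs : s ≠ 0) (hγ : γ ≠ 0) (hη : η ≠ 0)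
    (hh : h = η * t / (2 * (t - s))) {g p y z x' z' : E}
    (hx : x' = y - h • g) (hz : z' = z + (γ / s) • (x' - y)) :
    s ^ 2 * (s - 1) / (γ * η) * ‖z' - p‖ ^ 2 - s ^ 2 * (s - 1) / (γ * η) * ‖z - p‖ ^ 2
      = - (s * (s - 1) * (t / (t - s))) * inner ℝ g (z - p)
        + (s - 1) * γ * h ^ 2 / η * ‖g‖ ^ 2 := by
  have h1 : z' - p = (z - p) - (γ * h / s) • g := by
    rw [hz, hx]
    match_scalars <;> field_simp
    ring
  rw [h1, ← real_inner_self_eq_norm_sq, ← real_inner_self_eq_norm_sq, ← real_inner_self_eq_norm_sq]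
  generalize z - p = Z
  simp only [inner_sub_left, inner_sub_right, inner_smul_left, inner_smul_right,
    RCLike.conj_to_real]
  rw [real_inner_comm g Z]
  have : h = η * t / (2 * (t - s)) := hh
  field_simp
  rw [this]
  field_simp
  ring

/-- The exact change of the energy in one step of the scheme. -/
theorem energy_succ {s γ η t h : ℝ} (ht : t ≠ 0) (hts : t - s ≠ 0) (hs : s ≠ 0) (hγ : γ ≠ 0)
    (hη : η ≠ 0) (hh : h = η * t / (2 * (t - s))) {Gy Gy' e p y z x' y' z' : E}
    (hx : x' = y - h • (Gy + e)) (hz : z' = z + (γ / s) • (x' - y))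
    (hy : y' = ((t - s) / t) • x' + (s / t) • z') :
    energy s γ η t p Gy' y' z' - energy s γ η (t - 1) p Gy y z
      = - (t * (t - s)) * inner ℝ (Gy' - Gy) (y' - y) + η / 4 * t ^ 2 * ‖Gy' - Gy‖ ^ 2
        - η / 4 * (2 * t * (s - γ - 1) + 1) * ‖Gy‖ ^ 2
        - s * (s - 1) * inner ℝ Gy (y - p) - s ^ 2 * (s - 1) / (t - s) * inner ℝ Gy (z - p)
        - s * (s - 1) * (t / (t - s)) * inner ℝ e (z - p)
        - η / 2 * t ^ 2 * inner ℝ (Gy' - Gy) e - η * t / 2 * (s - γ) * inner ℝ Gy e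
        + (s - 1) * γ * h ^ 2 / η * ‖Gy + e‖ ^ 2 := by
  have h1 := gap_succ (Gy' := Gy') ht hts hs hh hx hz hy
  have h2 := sq_dist_succ (p := p) hts hs hγ hη hh hx hz
  have h3 : z - y = (z - p) - (y - p) := by abel
  rw [h3, inner_sub_right Gy] at h1
  rw [inner_add_left] at h2
  -- Splitting `t / (t - s) = 1 + s / (t - s)`: the leading part cancels `s (s - 1) ⟪Gy, z - p⟫`
  -- from the gap, and the rest is of order `1 / t`.
  have h4 : s * (s - 1) * (t / (t - s)) = s * (s - 1) + s ^ 2 * (s - 1) / (t - s) := by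
    field_simp
    ring
  rw [energy, energy]
  linear_combination h1 + h2 - h4 * inner ℝ Gy (z - p)

/-- The energy relative to a solution controls the residual and the distance to the solution. -/
theorem le_energy {s γ η a : ℝ} (hs : 1 < s) (hγ : 0 < γ) (hsγ : 1 + 3 * γ ≤ s) (hη : 0 < η)
    (ha : 0 ≤ a) {Gy p y z : E} (hGy : 0 ≤ inner ℝ Gy (y - p)) :
    η / 8 * (a ^ 2 * ‖Gy‖ ^ 2) + s ^ 2 / η * ‖z - p‖ ^ 2 ≤ energy s γ η a p Gy y z := by
  have h3 : z - y = (z - p) - (y - p) := by abel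
  rw [energy, gap, h3, inner_sub_right]
  -- `s ≥ 1 + 3 γ` provides three copies of `s² / η`: two absorb the cross term together with half
  -- of the residual term, and one survives.
  have h1 : 3 * (s ^ 2 / η) ≤ s ^ 2 * (s - 1) / (γ * η) := by
    rw [← mul_div_assoc, div_le_div_iff₀ hη (by positivity)]
    have : 0 ≤ s ^ 2 * η * (s - 1 - 3 * γ) := by
      apply mul_nonneg (by positivity)
      linarith
    linarith
  have h2 := real_inner_le_norm Gy (z - p)
  set n := ‖Gy‖
  set m := ‖z - p‖
  have h4 : a * s * inner ℝ Gy (z - p) ≤ η / 8 * (a ^ 2 * n ^ 2) + 2 * (s ^ 2 / η) * m ^ 2 := by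
    calc a * s * inner ℝ Gy (z - p) ≤ a * s * (n * m) := by gcongr
      _ ≤ _ := by
        have h5 : η / 8 * (a ^ 2 * n ^ 2) + 2 * (s ^ 2 / η) * m ^ 2 - a * s * (n * m)
            = η / 8 * (a * n - 4 * s * m / η) ^ 2 := by
          field_simp
          ring
        have : 0 ≤ η / 8 * (a * n - 4 * s * m / η) ^ 2 := by positivity
        linarith
  have h5 : 0 ≤ a * s * inner ℝ Gy (y - p) := by positivity
  have h6 := mul_le_mul_of_nonneg_right h1 (sq_nonneg m)
  linarith

/-- Young's inequality for an inner product. -/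
theorem abs_inner_le_young (u v : E) {c : ℝ} (hc : 0 < c) :
    |inner ℝ u v| ≤ (c * ‖u‖ ^ 2 + ‖v‖ ^ 2 / c) / 2 := by
  refine (abs_real_inner_le_norm u v).trans ?_
  have : (c * ‖u‖ ^ 2 + ‖v‖ ^ 2 / c) / 2 - ‖u‖ * ‖v‖ = (c * ‖u‖ - ‖v‖) ^ 2 / (2 * c) := by
    field_simp
    ring
  have : 0 ≤ (c * ‖u‖ - ‖v‖) ^ 2 / (2 * c) := by positivity
  linarith

theorem norm_add_sq_le (u v : E) : ‖u + v‖ ^ 2 ≤ 2 * ‖u‖ ^ 2 + 2 * ‖v‖ ^ 2 := by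
  have := parallelogram_law_with_norm ℝ u v
  nlinarith [sq_nonneg ‖u - v‖]

set_option maxHeartbeats 1000000 in
/-- One step of the scheme decreases the energy up to a summable factor and the estimator error. -/
theorem exists_energy_succ_le {s γ η ε : ℝ} (hs : 1 < s) (hγ : 0 < γ) (hsγ : 1 + 3 * γ ≤ s)
    (hη : 0 < η) (hε : 0 < ε) :
    ∃ C : ℝ, 0 ≤ C ∧ ∀ (t h μ : ℝ) (Gy Gy' e p y z x' y' z' : E), 3 * s + 1 ≤ t → 0 < μ →
      h = η * t / (2 * (t - s)) → x' = y - h • (Gy + e) → z' = z + (γ / s) • (x' - y) →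
      y' = ((t - s) / t) • x' + (s / t) • z' → 0 ≤ inner ℝ Gy (y - p) →
      energy s γ η t p Gy' y' z' ≤ (1 + C / t ^ 2) * energy s γ η (t - 1) p Gy y z
        - t * (t - s) * inner ℝ (Gy' - Gy) (y' - y)
        + η / 4 * (1 + μ) * t ^ 2 * ‖Gy' - Gy‖ ^ 2
        + (η / (4 * μ) + ε) * t ^ 2 * ‖e‖ ^ 2 + C * ‖e‖ ^ 2
        - η * γ * (t * ‖Gy‖ ^ 2) - s * (s - 1) * inner ℝ Gy (y - p) := by
  -- `K₁` to `K₄` are the constants of the remainders `T1` to `T4`; the last summand `K₄` of the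
  -- witness pays for the unweighted `‖e‖²`.
  obtain ⟨K₁, hK₁⟩ : ∃ K, K = 3 / 4 * s ^ 2 * (s - 1) := ⟨_, rfl⟩
  obtain ⟨K₂, hK₂⟩ : ∃ K, K = 3 / 2 * s * (s - 1) := ⟨_, rfl⟩
  obtain ⟨K₃, hK₃⟩ : ∃ K, K = η / 2 * (s - γ) := ⟨_, rfl⟩
  obtain ⟨K₄, hK₄⟩ : ∃ K, K = 2 * (s - 1) * γ * η := ⟨_, rfl⟩
  have hs1 : 0 < s - 1 := by linarith
  have hsγ' : 0 < s - γ := by linarith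
  have h1 : 0 < K₁ := by rw [hK₁]; positivity
  have h2 : 0 < K₂ := by rw [hK₂]; positivity
  have h3 : 0 < K₃ := by rw [hK₃]; positivity
  have h4 : 0 < K₄ := by rw [hK₄]; positivity
  refine ⟨K₁ * (15 / η + η) + K₂ ^ 2 / (2 * ε) * η + (K₃ ^ 2 / (2 * ε) + K₄) * (15 / η) + K₄,
    by positivity, ?_⟩
  intro t h μ Gy Gy' e p y z x' y' z' ht hμ hh hx hz hy hGy
  have ht0 : 0 < t := by linarith
  have hts : 0 < t - s := by linarith
  have hid := energy_succ (Gy' := Gy') (p := p) ht0.ne' hts.ne' (by linarith) hγ.ne' hη.ne' hh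
    hx hz hy
  have hlow := le_energy (z := z) (a := t - 1) hs hγ hsγ hη (by linarith) hGy
  generalize energy s γ η (t - 1) p Gy y z = X at hid hlow ⊢
  have hratio : 1 / (t - s) ≤ 3 / 2 / t := by
    rw [div_le_div_iff₀ hts ht0]
    linarith
  have hX : 0 ≤ X := le_trans (by positivity) hlow
  have hG : t ^ 2 * ‖Gy‖ ^ 2 ≤ 15 / η * X := by
    have h5 : t ^ 2 ≤ 15 / 8 * (t - 1) ^ 2 := by nlinarith
    have h6 : η / 8 * ((t - 1) ^ 2 * ‖Gy‖ ^ 2) ≤ X := by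
      have : 0 ≤ s ^ 2 / η * ‖z - p‖ ^ 2 := by positivity
      linarith
    calc t ^ 2 * ‖Gy‖ ^ 2 ≤ 15 / 8 * (t - 1) ^ 2 * ‖Gy‖ ^ 2 := by gcongr
      _ = 15 / η * (η / 8 * ((t - 1) ^ 2 * ‖Gy‖ ^ 2)) := by field_simp
      _ ≤ _ := by gcongr
  have hZ : ‖z - p‖ ^ 2 ≤ η * X := by
    have h6 : s ^ 2 / η * ‖z - p‖ ^ 2 ≤ X := by
      have : 0 ≤ η / 8 * ((t - 1) ^ 2 * ‖Gy‖ ^ 2) := by positivity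
      linarith
    calc ‖z - p‖ ^ 2 ≤ s ^ 2 * ‖z - p‖ ^ 2 := by
          apply le_mul_of_one_le_left (by positivity)
          nlinarith
      _ = η * (s ^ 2 / η * ‖z - p‖ ^ 2) := by field_simp
      _ ≤ _ := by gcongr
  have hG' : ‖Gy‖ ^ 2 ≤ 15 / η * X / t ^ 2 := by
    rw [le_div_iff₀ (by positivity)]
    linarith
  have T1 : - (s ^ 2 * (s - 1) / (t - s) * inner ℝ Gy (z - p))
      ≤ K₁ * (15 / η + η) * X / t ^ 2 := by
    calc - (s ^ 2 * (s - 1) / (t - s) * inner ℝ Gy (z - p))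
        = s ^ 2 * (s - 1) * (1 / (t - s)) * (- inner ℝ Gy (z - p)) := by ring
      _ ≤ s ^ 2 * (s - 1) * (1 / (t - s)) * |inner ℝ Gy (z - p)| := by
          gcongr
          exact neg_le_abs _
      _ ≤ s ^ 2 * (s - 1) * (3 / 2 / t) * ((t * ‖Gy‖ ^ 2 + ‖z - p‖ ^ 2 / t) / 2) := by
          gcongr
          exact abs_inner_le_young _ _ ht0
      _ = K₁ * (t ^ 2 * ‖Gy‖ ^ 2 + ‖z - p‖ ^ 2) / t ^ 2 := by
          rw [hK₁]
          field_simp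
          ring
      _ ≤ K₁ * (15 / η * X + η * X) / t ^ 2 := by gcongr
      _ = _ := by ring
  -- `T2` and `T3` spend half of `ε` each; the Young weights are chosen so that the other half of
  -- each bound is `O(X / t²)`.
  have T2 : - (s * (s - 1) * (t / (t - s)) * inner ℝ e (z - p))
      ≤ ε / 2 * t ^ 2 * ‖e‖ ^ 2 + K₂ ^ 2 / (2 * ε) * η * X / t ^ 2 := by
    calc - (s * (s - 1) * (t / (t - s)) * inner ℝ e (z - p))
        = s * (s - 1) * t * (1 / (t - s)) * (- inner ℝ e (z - p)) := by ring
      _ ≤ s * (s - 1) * t * (1 / (t - s)) * |inner ℝ e (z - p)| := by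
          gcongr
          exact neg_le_abs _
      _ ≤ s * (s - 1) * t * (3 / 2 / t) * ((ε * t ^ 2 / K₂ * ‖e‖ ^ 2
            + ‖z - p‖ ^ 2 / (ε * t ^ 2 / K₂)) / 2) := by
          gcongr
          exact abs_inner_le_young _ _ (by positivity)
      _ = K₂ * ((ε * t ^ 2 / K₂ * ‖e‖ ^ 2
            + ‖z - p‖ ^ 2 / (ε * t ^ 2 / K₂)) / 2) := by
          rw [hK₂]
          field_simp
      _ = ε / 2 * t ^ 2 * ‖e‖ ^ 2 + K₂ ^ 2 / (2 * ε) * ‖z - p‖ ^ 2 / t ^ 2 := by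
          field_simp
      _ ≤ ε / 2 * t ^ 2 * ‖e‖ ^ 2 + K₂ ^ 2 / (2 * ε) * (η * X) / t ^ 2 := by gcongr
      _ = _ := by ring
  have T3 : - (η * t / 2 * (s - γ) * inner ℝ Gy e)
      ≤ ε / 2 * t ^ 2 * ‖e‖ ^ 2 + K₃ ^ 2 / (2 * ε) * (15 / η) * X / t ^ 2 := by
    calc - (η * t / 2 * (s - γ) * inner ℝ Gy e) = K₃ * t * (- inner ℝ Gy e) := by rw [hK₃]; ring
      _ ≤ K₃ * t * |inner ℝ Gy e| := by
          gcongr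
          exact neg_le_abs _
      _ ≤ K₃ * t * ((K₃ / (ε * t) * ‖Gy‖ ^ 2 + ‖e‖ ^ 2 / (K₃ / (ε * t))) / 2) := by
          gcongr
          exact abs_inner_le_young _ _ (by positivity)
      _ = ε / 2 * t ^ 2 * ‖e‖ ^ 2 + K₃ ^ 2 / (2 * ε) * ‖Gy‖ ^ 2 := by
          field_simp
          ring
      _ ≤ ε / 2 * t ^ 2 * ‖e‖ ^ 2 + K₃ ^ 2 / (2 * ε) * (15 / η * X / t ^ 2) := by gcongr
      _ = _ := by ring
  have hh0 : 0 ≤ h := by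
    rw [hh]
    positivity
  have hh1 : h ≤ 3 / 4 * η := by
    rw [hh, div_le_iff₀ (by positivity)]
    nlinarith
  have T4 : (s - 1) * γ * h ^ 2 / η * ‖Gy + e‖ ^ 2
      ≤ K₄ * (15 / η) * X / t ^ 2 + K₄ * ‖e‖ ^ 2 := by
    calc (s - 1) * γ * h ^ 2 / η * ‖Gy + e‖ ^ 2
        ≤ (s - 1) * γ * η ^ 2 / η * (2 * ‖Gy‖ ^ 2 + 2 * ‖e‖ ^ 2) := by
          gcongr
          · linarith
          · exact norm_add_sq_le _ _
      _ = K₄ * ‖Gy‖ ^ 2 + K₄ * ‖e‖ ^ 2 := by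
          rw [hK₄]
          field_simp
      _ ≤ K₄ * (15 / η * X / t ^ 2) + K₄ * ‖e‖ ^ 2 := by gcongr
      _ = _ := by ring
  -- The only cross term of full order `t²`; its Young parameter `μ` stays free so that it can be
  -- matched to the delay.
  have T5 : - (η / 2 * t ^ 2 * inner ℝ (Gy' - Gy) e)
      ≤ η / 4 * μ * t ^ 2 * ‖Gy' - Gy‖ ^ 2 + η / (4 * μ) * t ^ 2 * ‖e‖ ^ 2 := by
    calc - (η / 2 * t ^ 2 * inner ℝ (Gy' - Gy) e)
        = η / 2 * t ^ 2 * (- inner ℝ (Gy' - Gy) e) := by ring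
      _ ≤ η / 2 * t ^ 2 * |inner ℝ (Gy' - Gy) e| := by
          gcongr
          exact neg_le_abs _
      _ ≤ η / 2 * t ^ 2 * ((μ * ‖Gy' - Gy‖ ^ 2 + ‖e‖ ^ 2 / μ) / 2) := by
          gcongr
          exact abs_inner_le_young _ _ hμ
      _ = _ := by
          field_simp
          ring
  -- Here `s - γ - 1 ≥ 2 γ`.
  have T6 : η * γ * (t * ‖Gy‖ ^ 2) ≤ η / 4 * (2 * t * (s - γ - 1) + 1) * ‖Gy‖ ^ 2 := by
    have : 0 ≤ η * ‖Gy‖ ^ 2 * (2 * t * (s - 1 - 3 * γ) + 1) := by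
      have : 0 ≤ s - 1 - 3 * γ := by linarith
      positivity
    linarith
  have T7 : 0 ≤ (K₁ * (15 / η + η) + K₂ ^ 2 / (2 * ε) * η + (K₃ ^ 2 / (2 * ε) + K₄) * (15 / η))
      * ‖e‖ ^ 2 := by positivity
  have T8 : 0 ≤ K₄ * X / t ^ 2 := by positivity
  have T9 : (K₁ * (15 / η + η) + K₂ ^ 2 / (2 * ε) * η + (K₃ ^ 2 / (2 * ε) + K₄) * (15 / η) + K₄)
      / t ^ 2 * X = K₁ * (15 / η + η) * X / t ^ 2 + K₂ ^ 2 / (2 * ε) * η * X / t ^ 2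
        + K₃ ^ 2 / (2 * ε) * (15 / η) * X / t ^ 2 + K₄ * (15 / η) * X / t ^ 2 + K₄ * X / t ^ 2 := by
    ring
  rw [add_mul 1, T9]
  linarith

end Energy

/-! ### Lipschitz continuity from co-coercivity. -/

section Cocoercive

variable {E : Type*} [NormedAddCommGroup E] [InnerProductSpace ℝ E] {G : E → E} {β : ℝ}

theorem mul_norm_sub_le_of_cocoercive
    (hG : ∀ u v, β * ‖G u - G v‖ ^ 2 ≤ inner ℝ (G u - G v) (u - v)) (u v : E) :
    β * ‖G u - G v‖ ≤ ‖u - v‖ := by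
  have h1 := (hG u v).trans (real_inner_le_norm _ _)
  rcases (norm_nonneg (G u - G v)).eq_or_lt with h | h
  · rw [← h, mul_zero]
    exact norm_nonneg _
  · refine le_of_mul_le_mul_right ?_ h
    linarith

theorem continuous_of_cocoercive (hβ : 0 < β)
    (hG : ∀ u v, β * ‖G u - G v‖ ^ 2 ≤ inner ℝ (G u - G v) (u - v)) : Continuous G := by
  have : LipschitzWith (Real.toNNReal (1 / β)) G := by
    refine LipschitzWith.of_dist_le_mul fun u v => ?_
    rw [dist_eq_norm, dist_eq_norm, Real.coe_toNNReal _ (by positivity), one_div,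
      inv_mul_eq_div, le_div_iff₀ hβ, mul_comm]
    exact mul_norm_sub_le_of_cocoercive hG u v
  exact this.continuous

end Cocoercive

/-! ### The weights `t_k`. -/

section Weights

variable {s : ℝ} {τ : ℕ}

theorem tSeq_succ (s : ℝ) (τ k : ℕ) : tSeq s τ (k + 1) = tSeq s τ k + 1 := by
  simp only [tSeq]
  push_cast
  ring

theorem le_tSeq (s : ℝ) (hτ : 1 ≤ τ) (k : ℕ) : 3 * s + 1 ≤ tSeq s τ k := by
  have h1 : (0 : ℝ) ≤ k := k.cast_nonneg
  have h2 : (1 : ℝ) ≤ τ := by exact_mod_cast hτ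
  simp only [tSeq]
  linarith

theorem summable_inv_tSeq_sq (hs : 1 < s) (τ : ℕ) : Summable fun k => 1 / tSeq s τ k ^ 2 := by
  have h := (summable_nat_add_iff 1).2 (Real.summable_one_div_nat_pow.2 one_lt_two)
  refine h.of_nonneg_of_le (fun k => by positivity) fun k => ?_
  have h1 : (0 : ℝ) ≤ τ := τ.cast_nonneg
  have h2 : (0 : ℝ) ≤ k := k.cast_nonneg
  gcongr
  simp only [tSeq]
  push_cast
  linarith

end Weights

/-! ### A single path: energy decrease and vanishing of `z - y`. -/

section Run

variable {E : Type*} [NormedAddCommGroup E] [InnerProductSpace ℝ E]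

/-- The deterministic sequences generated by the scheme for a co-coercive operator, with estimator
errors that are square summable with weights `tₖ²`. -/
structure ControlledRun (G : E → E) (β s γ η : ℝ) (τ : ℕ) (g x y z : ℕ → E) : Prop where
  one_lt_s : 1 < s
  gamma_pos : 0 < γ
  gamma_le : 1 + 3 * γ ≤ s
  one_le_tau : 1 ≤ τ
  eta_pos : 0 < η
  eta_le : 2 * η ≤ β
  cocoercive : ∀ u v, β * ‖G u - G v‖ ^ 2 ≤ inner ℝ (G u - G v) (u - v)
  x_succ : ∀ k, x (k + 1) = y k - etaSeq η s τ k • g k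
  z_succ : ∀ k, z (k + 1) = z k + (γ / s) • (x (k + 1) - y k)
  y_succ : ∀ k, y (k + 1) = ((tSeq s τ k - s) / tSeq s τ k) • x (k + 1)
    + (s / tSeq s τ k) • z (k + 1)
  summable_error : Summable fun k => tSeq s τ k ^ 2 * ‖g k - G (y k)‖ ^ 2

namespace ControlledRun

variable {G : E → E} {β s γ η : ℝ} {τ : ℕ} {g x y z : ℕ → E}

theorem t_pos (H : ControlledRun G β s γ η τ g x y z) (k : ℕ) : 0 < tSeq s τ k := by
  linarith [H.one_lt_s, le_tSeq s H.one_le_tau k]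

theorem t_sub_pos (H : ControlledRun G β s γ η τ g x y z) (k : ℕ) : 0 < tSeq s τ k - s := by
  linarith [H.one_lt_s, le_tSeq s H.one_le_tau k]

theorem monotone (H : ControlledRun G β s γ η τ g x y z) (k : ℕ) :
    0 ≤ inner ℝ (G (y (k + 1)) - G (y k)) (y (k + 1) - y k)
      - β * ‖G (y (k + 1)) - G (y k)‖ ^ 2 := by
  linarith [H.cocoercive (y (k + 1)) (y k)]

theorem inner_nonneg (H : ControlledRun G β s γ η τ g x y z) {p : E} (hp : p ∈ zer G) (u : E) :
    0 ≤ inner ℝ (G u) (u - p) := by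
  have h1 := H.cocoercive u p
  have h2 : G p = 0 := hp
  have h3 : 0 < β := by linarith [H.eta_pos, H.eta_le]
  rw [h2, sub_zero] at h1
  exact le_trans (by positivity) h1

/-- The energy relative to a solution converges, and its decrements are summable. -/
theorem energy_summable (H : ControlledRun G β s γ η τ g x y z) {p : E} (hp : p ∈ zer G) :
    (Summable fun k => tSeq s τ k * ‖G (y k)‖ ^ 2) ∧
    (Summable fun k => tSeq s τ k ^ 2 * ‖G (y (k + 1)) - G (y k)‖ ^ 2) ∧
    (Summable fun k => tSeq s τ k * (tSeq s τ k - s)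
      * inner ℝ (G (y (k + 1)) - G (y k)) (y (k + 1) - y k)) ∧
    ∃ l, Tendsto (fun k => energy s γ η (tSeq s τ k - 1) p (G (y k)) (y k) (z k))
      atTop (𝓝 l) := by
  obtain ⟨C, hC, hstep⟩ := exists_energy_succ_le (E := E) (s := s) (γ := γ) (η := η) (ε := 1)
    H.one_lt_s H.gamma_pos H.gamma_le H.eta_pos one_pos
  have hs := H.one_lt_s
  have hη := H.eta_pos
  have hγ := H.gamma_pos
  have ht := fun k => le_tSeq s H.one_le_tau k
  have hW : ∀ k, 0 < tSeq s τ k * (tSeq s τ k - s) := fun k => mul_pos (H.t_pos k) (H.t_sub_pos k)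
  have hr := H.monotone
  have htW : ∀ k, tSeq s τ k ^ 2 ≤ 3 / 2 * (tSeq s τ k * (tSeq s τ k - s)) := fun k => by
    nlinarith [ht k, H.t_pos k]
  -- With `μ = 2` and `t² ≤ 3/2 W`, `W = t (t - s)`, Young's inequality costs `9/8 η W` per squared
  -- increment, while `β ≥ 2 η`; this leaves the `7/8 η` in the decrement.
  have key := summable_and_tendsto_of_le
    (X := fun k => energy s γ η (tSeq s τ k - 1) p (G (y k)) (y k) (z k))
    (A := fun k => tSeq s τ k * (tSeq s τ k - s) *
        (inner ℝ (G (y (k + 1)) - G (y k)) (y (k + 1) - y k)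
          - β * ‖G (y (k + 1)) - G (y k)‖ ^ 2)
      + 7 / 8 * η * (tSeq s τ k * (tSeq s τ k - s) * ‖G (y (k + 1)) - G (y k)‖ ^ 2)
      + η * γ * (tSeq s τ k * ‖G (y k)‖ ^ 2))
    (a := fun k => C / tSeq s τ k ^ 2)
    (b := fun k => (η / 8 + 1 + C) * (tSeq s τ k ^ 2 * ‖g k - G (y k)‖ ^ 2))
    (fun k => le_trans (by positivity)
      (le_energy hs hγ H.gamma_le hη (by linarith [ht k]) (H.inner_nonneg hp _)))
    (fun k => by
      have h1 := hW k
      have h2 := H.t_pos k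
      have h3 := mul_nonneg h1.le (hr k)
      have h4 : 0 ≤ 7 / 8 * η * (tSeq s τ k * (tSeq s τ k - s) * ‖G (y (k + 1)) - G (y k)‖ ^ 2) := by
        have := H.t_sub_pos k
        positivity
      have h5 : 0 ≤ η * γ * (tSeq s τ k * ‖G (y k)‖ ^ 2) := by positivity
      linarith)
    (fun k => by positivity) (fun k => by positivity)
    (by simpa [div_eq_mul_inv] using (summable_inv_tSeq_sq hs τ).mul_left C)
    (H.summable_error.mul_left _)
    (fun k => by
      have h1 := hstep (tSeq s τ k) (etaSeq η s τ k) 2 (G (y k)) (G (y (k + 1)))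
        (g k - G (y k)) p (y k) (z k) (x (k + 1)) (y (k + 1)) (z (k + 1)) (ht k) two_pos rfl
        (by rw [add_sub_cancel]; exact H.x_succ k) (H.z_succ k) (H.y_succ k) (H.inner_nonneg hp _)
      rw [tSeq_succ, add_sub_cancel_right]
      have h2 : 0 ≤ s * (s - 1) * inner ℝ (G (y k)) (y k - p) :=
        mul_nonneg (by nlinarith) (H.inner_nonneg hp _)
      have h3 : C * ‖g k - G (y k)‖ ^ 2 ≤ C * (tSeq s τ k ^ 2 * ‖g k - G (y k)‖ ^ 2) := by
        gcongr
        exact le_mul_of_one_le_left (by positivity) (by nlinarith [ht k])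
      have h4 : η / 4 * (1 + 2) * tSeq s τ k ^ 2 * ‖G (y (k + 1)) - G (y k)‖ ^ 2
          ≤ 9 / 8 * η * (tSeq s τ k * (tSeq s τ k - s) * ‖G (y (k + 1)) - G (y k)‖ ^ 2) := by
        have := mul_le_mul_of_nonneg_left (htW k)
          (show 0 ≤ 3 / 4 * η * ‖G (y (k + 1)) - G (y k)‖ ^ 2 by positivity)
        linarith
      have h5 : 2 * η * (tSeq s τ k * (tSeq s τ k - s) * ‖G (y (k + 1)) - G (y k)‖ ^ 2)
          ≤ β * (tSeq s τ k * (tSeq s τ k - s) * ‖G (y (k + 1)) - G (y k)‖ ^ 2) :=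
        mul_le_mul_of_nonneg_right H.eta_le
          (mul_nonneg (hW k).le (sq_nonneg _))
      linarith)
  obtain ⟨hA, hX⟩ := key
  have hA1 : ∀ k, 0 ≤ tSeq s τ k * (tSeq s τ k - s) *
      (inner ℝ (G (y (k + 1)) - G (y k)) (y (k + 1) - y k)
        - β * ‖G (y (k + 1)) - G (y k)‖ ^ 2) := fun k => mul_nonneg (hW k).le (hr k)
  have hA2 : ∀ k, 0 ≤ tSeq s τ k * (tSeq s τ k - s) * ‖G (y (k + 1)) - G (y k)‖ ^ 2 := fun k =>
    mul_nonneg (hW k).le (sq_nonneg _)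
  have hA3 : ∀ k, 0 ≤ tSeq s τ k * ‖G (y k)‖ ^ 2 := fun k =>
    mul_nonneg (H.t_pos k).le (sq_nonneg _)
  have hηγ : 0 < η * γ := by positivity
  have hs2 : Summable fun k => tSeq s τ k * (tSeq s τ k - s) * ‖G (y (k + 1)) - G (y k)‖ ^ 2 := by
    refine (hA.mul_left (8 / (7 * η))).of_nonneg_of_le hA2 fun k => ?_
    have h1 := hA1 k
    have h3 := mul_nonneg hηγ.le (hA3 k)
    rw [div_mul_eq_mul_div, le_div_iff₀ (by positivity)]
    linarith
  refine ⟨?_, ?_, ?_, hX⟩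
  · refine (hA.mul_left (1 / (η * γ))).of_nonneg_of_le hA3 fun k => ?_
    have h1 := hA1 k
    have h3 := mul_nonneg hη.le (hA2 k)
    rw [div_mul_eq_mul_div, le_div_iff₀ (by positivity)]
    linarith
  · refine (hs2.mul_left (3 / 2)).of_nonneg_of_le (fun k => by positivity) fun k => ?_
    have := mul_le_mul_of_nonneg_right (htW k) (sq_nonneg ‖G (y (k + 1)) - G (y k)‖)
    linarith
  · have hs1 : Summable fun k => tSeq s τ k * (tSeq s τ k - s) *
        (inner ℝ (G (y (k + 1)) - G (y k)) (y (k + 1) - y k)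
          - β * ‖G (y (k + 1)) - G (y k)‖ ^ 2) := by
      refine hA.of_nonneg_of_le hA1 fun k => ?_
      have h2 := mul_nonneg hη.le (hA2 k)
      have h3 := mul_nonneg hηγ.le (hA3 k)
      linarith
    exact (hs1.add (hs2.mul_left β)).congr fun k => by ring

/-- The estimators are square summable with weights `tₖ`. -/
theorem summable_estimator (H : ControlledRun G β s γ η τ g x y z) (hne : (zer G).Nonempty) :
    Summable fun k => tSeq s τ k * ‖g k‖ ^ 2 := by
  obtain ⟨p, hp⟩ := hne
  have h1 := (H.energy_summable hp).1
  refine ((h1.add H.summable_error).mul_left 2).of_nonneg_of_le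
    (fun k => mul_nonneg (H.t_pos k).le (sq_nonneg _)) fun k => ?_
  have h2 := norm_add_sq_le (G (y k)) (g k - G (y k))
  rw [add_sub_cancel] at h2
  have h3 : tSeq s τ k ≤ tSeq s τ k ^ 2 := by
    nlinarith [H.one_lt_s, le_tSeq s H.one_le_tau k]
  calc tSeq s τ k * ‖g k‖ ^ 2
      ≤ tSeq s τ k * (2 * ‖G (y k)‖ ^ 2 + 2 * ‖g k - G (y k)‖ ^ 2) :=
        mul_le_mul_of_nonneg_left h2 (H.t_pos k).le
    _ = 2 * (tSeq s τ k * ‖G (y k)‖ ^ 2) + 2 * (tSeq s τ k * ‖g k - G (y k)‖ ^ 2) := by ring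
    _ ≤ 2 * (tSeq s τ k * ‖G (y k)‖ ^ 2) + 2 * (tSeq s τ k ^ 2 * ‖g k - G (y k)‖ ^ 2) := by
        gcongr
    _ = _ := by ring

/-- A convex combination of the old difference and a vector of size `t ‖g‖`. Convexity of the
squared norm then yields the factor `1 - s / t` and a forcing of order `t ‖g‖²`, which is summable.
-/
theorem sub_succ (H : ControlledRun G β s γ η τ g x y z) (k : ℕ) :
    z (k + 1) - y (k + 1) = (1 - s / tSeq s τ k) • (z k - y k)
      + (s / tSeq s τ k) • ((η / 2 * (s - γ) * tSeq s τ k / s ^ 2) • g k) := by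
  have h1 := (H.t_pos k).ne'
  have h2 := (H.t_sub_pos k).ne'
  have h3 : s ≠ 0 := by linarith [H.one_lt_s]
  rw [H.y_succ k, H.z_succ k, H.x_succ k, etaSeq]
  match_scalars <;> field_simp <;> ring

/-- The gap between `z` and `y` vanishes. -/
theorem sub_tendsto_zero (H : ControlledRun G β s γ η τ g x y z) (hne : (zer G).Nonempty) :
    (Summable fun k => ‖z k - y k‖ ^ 2 / tSeq s τ k) ∧
      Tendsto (fun k => ‖z k - y k‖ ^ 2) atTop (𝓝 0) := by
  have hs := H.one_lt_s
  have key := summable_and_tendsto_of_le (X := fun k => ‖z k - y k‖ ^ 2)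
    (A := fun k => s * (‖z k - y k‖ ^ 2 / tSeq s τ k)) (a := fun _ => 0)
    (b := fun k => (η / 2 * (s - γ)) ^ 2 / s ^ 3 * (tSeq s τ k * ‖g k‖ ^ 2))
    (fun k => sq_nonneg _)
    (fun k => by have := H.t_pos k; positivity) (fun k => le_rfl)
    (fun k => by have := H.t_pos k; positivity) summable_zero
    ((H.summable_estimator hne).mul_left _)
    (fun k => by
      have ht := H.t_pos k
      have hts := H.t_sub_pos k
      have h1 : s / tSeq s τ k ≤ 1 := by
        rw [div_le_one ht]
        linarith
      have h0 : 0 ≤ s / tSeq s τ k := by positivity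
      have hconv := (convexOn_univ_norm (E := E)).pow (fun _ _ => norm_nonneg _) 2
      have := hconv.2 (Set.mem_univ (z k - y k))
        (Set.mem_univ ((η / 2 * (s - γ) * tSeq s τ k / s ^ 2) • g k))
        (sub_nonneg.2 h1) h0 (sub_add_cancel _ _)
      rw [← H.sub_succ k] at this
      simp only [Pi.pow_apply, smul_eq_mul, norm_smul, Real.norm_eq_abs, mul_pow, sq_abs] at this
      refine this.trans (le_of_eq ?_)
      field_simp
      ring)
  obtain ⟨hA, l, hl⟩ := key
  have hA' : Summable fun k => ‖z k - y k‖ ^ 2 / tSeq s τ k :=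
    (hA.mul_left (1 / s)).congr fun k => by field_simp
  refine ⟨hA', tendsto_zero_of_summable_div (c := 3 * s + τ) (by positivity)
    (fun k => sq_nonneg _) hl (hA'.congr fun k => ?_)⟩
  rw [tSeq, add_assoc]

end ControlledRun

end Run

/-! ### A single path: residuals, rates and convergence. -/

section Run

variable {E : Type*} [NormedAddCommGroup E] [InnerProductSpace ℝ E]

/-- Inner products of two square summable sequences are absolutely summable. -/
theorem summable_mul_inner {u v : ℕ → E} {c : ℕ → ℝ} (hc : ∀ k, 0 < c k)
    (hu : Summable fun k => c k * ‖u k‖ ^ 2) (hv : Summable fun k => ‖v k‖ ^ 2 / c k) :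
    Summable fun k => (inner ℝ (u k) (v k) : ℝ) := by
  refine Summable.of_norm_bounded ((hu.add hv).div_const 2) fun k => ?_
  exact abs_inner_le_young _ _ (hc k)

namespace ControlledRun

variable {G : E → E} {β s γ η : ℝ} {τ : ℕ} {g x y z : ℕ → E}

/-- Every term of `gap_succ` is already summable, or is an inner product of two sequences that are
square summable for dual weights. The gap thus converges independently of any solution, which
separates it from the distance part of the energy. -/
theorem summable_gap_increments (H : ControlledRun G β s γ η τ g x y z)
    (hne : (zer G).Nonempty) :
    Summable fun k => gap s η (tSeq s τ (k + 1) - 1) (G (y (k + 1))) (y (k + 1)) (z (k + 1))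
      - gap s η (tSeq s τ k - 1) (G (y k)) (y k) (z k) := by
  obtain ⟨p, hp⟩ := id hne
  obtain ⟨h1, h2, h3, -⟩ := H.energy_summable hp
  have h4 := (H.sub_tendsto_zero hne).1
  have h5 := H.summable_error
  have hs := H.one_lt_s
  have ht1 : ∀ k, 1 ≤ tSeq s τ k := fun k => by linarith [le_tSeq s H.one_le_tau k]
  have hG : Summable fun k => ‖G (y k)‖ ^ 2 :=
    h1.of_nonneg_of_le (fun k => sq_nonneg _) fun k =>
      le_mul_of_one_le_left (sq_nonneg _) (ht1 k)
  have s1 : Summable fun k => (inner ℝ (G (y k)) (z k - y k) : ℝ) :=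
    summable_mul_inner H.t_pos h1 h4
  have s2 : Summable fun k =>
      tSeq s τ k ^ 2 * (inner ℝ (G (y (k + 1)) - G (y k)) (g k - G (y k)) : ℝ) := by
    have := summable_mul_inner (c := fun _ => 1)
      (u := fun k => tSeq s τ k • (G (y (k + 1)) - G (y k)))
      (v := fun k => tSeq s τ k • (g k - G (y k))) (fun _ => one_pos)
      (h2.congr fun k => by simp [norm_smul, mul_pow]) (h5.congr fun k => by simp [norm_smul, mul_pow])
    refine this.congr fun k => ?_
    rw [real_inner_smul_left, real_inner_smul_right]
    ring
  have s3 : Summable fun k => tSeq s τ k * (inner ℝ (G (y k)) (g k - G (y k)) : ℝ) := by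
    have := summable_mul_inner (c := fun _ => 1) (u := fun k => G (y k))
      (v := fun k => tSeq s τ k • (g k - G (y k))) (fun _ => one_pos)
      (hG.congr fun k => by simp) (h5.congr fun k => by simp [norm_smul, mul_pow])
    refine this.congr fun k => ?_
    rw [real_inner_smul_right]
  refine (((((h3.mul_left (-1)).add (h2.mul_left (η / 4))).sub
    ((h1.mul_left (η / 4 * (2 * (s - γ - 1)))).add (hG.mul_left (η / 4)))).add
    (s1.mul_left (s * (s - 1)))).sub ((s2.mul_left (η / 2)).add
      (s3.mul_left (η / 2 * (s - γ))))).congr fun k => ?_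
  rw [tSeq_succ, add_sub_cancel_right,
    gap_succ (h := etaSeq η s τ k) (x' := x (k + 1)) (γ := γ) (e := g k - G (y k))
      (H.t_pos k).ne' (H.t_sub_pos k).ne' (by linarith) rfl
      (by rw [add_sub_cancel]; exact H.x_succ k) (H.z_succ k) (H.y_succ k)]
  ring

theorem sq_mul_le (H : ControlledRun G β s γ η τ g x y z) (k : ℕ) :
    tSeq s τ k ^ 2 ≤ 2 * (tSeq s τ k - 1) ^ 2 := by
  nlinarith [le_tSeq s H.one_le_tau k, H.one_lt_s]

/-- The residuals vanish faster than `1 / tₖ`, the gap vanishes, and the distance of `z` to any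
solution converges. -/
theorem residual_tendsto (H : ControlledRun G β s γ η τ g x y z) (hne : (zer G).Nonempty) :
    Tendsto (fun k => tSeq s τ k ^ 2 * ‖G (y k)‖ ^ 2) atTop (𝓝 0) ∧
      ∀ p ∈ zer G, ∃ l, Tendsto (fun k => ‖z k - p‖ ^ 2) atTop (𝓝 l) := by
  obtain ⟨p₀, hp₀⟩ := id hne
  have hs := H.one_lt_s
  have hη := H.eta_pos
  have hγ := H.gamma_pos
  obtain ⟨h1, -, -, L, hL⟩ := H.energy_summable hp₀
  have ha : ∀ k, 0 < tSeq s τ k - 1 := fun k => by linarith [le_tSeq s H.one_le_tau k]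
  obtain ⟨F, hF⟩ : ∃ F, Tendsto (fun k => gap s η (tSeq s τ k - 1) (G (y k)) (y k) (z k))
      atTop (𝓝 F) := by
    have := (H.summable_gap_increments hne).hasSum.tendsto_sum_nat
    refine ⟨_, (this.add_const (gap s η (tSeq s τ 0 - 1) (G (y 0)) (y 0) (z 0))).congr fun n => ?_⟩
    rw [Finset.sum_range_sub (fun k => gap s η (tSeq s τ k - 1) (G (y k)) (y k) (z k))]
    ring
  -- The energy bounds `(t - 1) ‖G y‖`, while `z - y` tends to zero.
  have hcross : Tendsto (fun k => (tSeq s τ k - 1) * (inner ℝ (G (y k)) (z k - y k) : ℝ)) atTop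
      (𝓝 0) := by
    obtain ⟨M, hM⟩ := hL.bddAbove_range
    have hMk : ∀ k, ((tSeq s τ k - 1) * ‖G (y k)‖) ^ 2 ≤ 8 / η * M := fun k => by
      have h2 := le_energy (z := z k) hs hγ H.gamma_le hη (ha k).le (H.inner_nonneg hp₀ (y k))
      have h3 : energy s γ η (tSeq s τ k - 1) p₀ (G (y k)) (y k) (z k) ≤ M := hM ⟨k, rfl⟩
      have h4 : 0 ≤ s ^ 2 / η * ‖z k - p₀‖ ^ 2 := by positivity
      rw [div_mul_eq_mul_div, le_div_iff₀ hη]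
      linarith
    have h5 : Tendsto (fun k => Real.sqrt (8 / η * M) * ‖z k - y k‖) atTop (𝓝 0) := by
      have := (H.sub_tendsto_zero hne).2.sqrt
      simp only [Real.sqrt_sq (norm_nonneg _), Real.sqrt_zero] at this
      simpa using this.const_mul (Real.sqrt (8 / η * M))
    refine squeeze_zero_norm (fun k => ?_) h5
    rw [norm_mul, Real.norm_eq_abs, Real.norm_eq_abs, abs_of_pos (ha k)]
    calc (tSeq s τ k - 1) * |inner ℝ (G (y k)) (z k - y k)|
        ≤ (tSeq s τ k - 1) * (‖G (y k)‖ * ‖z k - y k‖) :=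
          mul_le_mul_of_nonneg_left (abs_real_inner_le_norm _ _) (ha k).le
      _ = (tSeq s τ k - 1) * ‖G (y k)‖ * ‖z k - y k‖ := by ring
      _ ≤ _ := mul_le_mul_of_nonneg_right (Real.le_sqrt_of_sq_le (hMk k)) (norm_nonneg _)
  have hlim : Tendsto (fun k => (tSeq s τ k - 1) ^ 2 * ‖G (y k)‖ ^ 2) atTop (𝓝 (4 / η * F)) := by
    have := (hF.add (hcross.const_mul s)).const_mul (4 / η)
    rw [mul_zero, add_zero] at this
    refine this.congr fun k => ?_
    rw [gap]
    field_simp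
    ring
  have hzero : Tendsto (fun k => (tSeq s τ k - 1) ^ 2 * ‖G (y k)‖ ^ 2) atTop (𝓝 0) := by
    refine tendsto_zero_of_summable_div (c := 3 * s + τ - 1)
      (by have : (0 : ℝ) ≤ τ := τ.cast_nonneg
          linarith) (fun k => by positivity) hlim ?_
    refine h1.of_nonneg_of_le (fun k => ?_) (fun k => ?_)
    all_goals
      rw [show (k : ℝ) + (3 * s + τ - 1) = tSeq s τ k - 1 by rw [tSeq]; ring]
      have := ha k
    · positivity
    · rw [div_le_iff₀ this]
      have h6 : (tSeq s τ k - 1) ^ 2 ≤ tSeq s τ k * (tSeq s τ k - 1) := by nlinarith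
      have := mul_le_mul_of_nonneg_right h6 (sq_nonneg ‖G (y k)‖)
      linarith
  have hF0 : Tendsto (fun k => gap s η (tSeq s τ k - 1) (G (y k)) (y k) (z k)) atTop (𝓝 0) := by
    have := (hzero.const_mul (η / 4)).sub (hcross.const_mul s)
    rw [mul_zero, mul_zero, sub_zero] at this
    refine this.congr fun k => ?_
    rw [gap]
    ring
  refine ⟨?_, fun p hp => ?_⟩
  · have := hzero.const_mul 2
    rw [mul_zero] at this
    refine squeeze_zero (fun k => by positivity) (fun k => ?_) this
    have := mul_le_mul_of_nonneg_right (H.sq_mul_le k) (sq_nonneg ‖G (y k)‖)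
    linarith
  · obtain ⟨-, -, -, l, hl⟩ := H.energy_summable hp
    have hs1 : 0 < s - 1 := by linarith
    refine ⟨_, ((hl.sub hF0).const_mul (γ * η / (s ^ 2 * (s - 1)))).congr fun k => ?_⟩
    rw [energy]
    field_simp
    ring

/-- A bound for the increments of `x`. -/
theorem exists_sq_increment_le (H : ControlledRun G β s γ η τ g x y z) :
    ∃ C : ℝ, 0 ≤ C ∧ ∀ k, tSeq s τ k ^ 2 * ‖x (k + 2) - x (k + 1)‖ ^ 2
      ≤ C * (‖z (k + 1) - y (k + 1)‖ ^ 2 + tSeq s τ (k + 1) ^ 2 * ‖G (y (k + 1))‖ ^ 2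
        + tSeq s τ (k + 1) ^ 2 * ‖g (k + 1) - G (y (k + 1))‖ ^ 2) := by
  have hs := H.one_lt_s
  have hη := H.eta_pos
  refine ⟨2 * (2 * s) ^ 2 + 4 * η ^ 2, by positivity, fun k => ?_⟩
  have ht := H.t_pos k
  have hts := H.t_sub_pos k
  -- `x (k + 2) - y (k + 1)` is a multiple of the estimator; the other part of the increment is `z -
  -- y` with a factor of order `1 / t`.
  have hyx : y (k + 1) - x (k + 1) = (s / (tSeq s τ k - s)) • (z (k + 1) - y (k + 1)) := by
    rw [H.y_succ k]
    match_scalars <;> field_simp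
    ring
  have hx : x (k + 2) - x (k + 1) = (s / (tSeq s τ k - s)) • (z (k + 1) - y (k + 1))
      + (-etaSeq η s τ (k + 1)) • (G (y (k + 1)) + (g (k + 1) - G (y (k + 1)))) := by
    rw [← hyx, H.x_succ (k + 1), add_sub_cancel, neg_smul]
    abel
  have h1 : tSeq s τ k * (s / (tSeq s τ k - s)) ≤ 2 * s := by
    rw [← mul_div_assoc, div_le_iff₀ hts]
    nlinarith [le_tSeq s H.one_le_tau k]
  have h1' : 0 ≤ tSeq s τ k * (s / (tSeq s τ k - s)) := by positivity
  have h2 : tSeq s τ k * etaSeq η s τ (k + 1) ≤ η * tSeq s τ (k + 1) := by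
    have h3 := H.t_sub_pos (k + 1)
    have h4 := H.t_pos (k + 1)
    rw [etaSeq, ← mul_div_assoc, div_le_iff₀ (by positivity)]
    have h5 : tSeq s τ k ≤ 2 * (tSeq s τ (k + 1) - s) := by
      linarith [tSeq_succ s τ k, le_tSeq s H.one_le_tau (k + 1)]
    have := mul_le_mul_of_nonneg_left h5 (show 0 ≤ η * tSeq s τ (k + 1) by positivity)
    linarith
  have h2' : 0 ≤ tSeq s τ k * etaSeq η s τ (k + 1) := by
    have h3 := H.t_sub_pos (k + 1)
    have h4 := H.t_pos (k + 1)
    rw [etaSeq]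
    positivity
  have h3 := norm_add_sq_le (G (y (k + 1))) (g (k + 1) - G (y (k + 1)))
  calc tSeq s τ k ^ 2 * ‖x (k + 2) - x (k + 1)‖ ^ 2
      ≤ tSeq s τ k ^ 2 * (2 * ‖(s / (tSeq s τ k - s)) • (z (k + 1) - y (k + 1))‖ ^ 2
        + 2 * ‖(-etaSeq η s τ (k + 1)) • (G (y (k + 1)) + (g (k + 1) - G (y (k + 1))))‖ ^ 2) := by
        rw [hx]
        gcongr
        exact norm_add_sq_le _ _
    _ = 2 * (tSeq s τ k * (s / (tSeq s τ k - s))) ^ 2 * ‖z (k + 1) - y (k + 1)‖ ^ 2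
        + 2 * (tSeq s τ k * etaSeq η s τ (k + 1)) ^ 2
          * ‖G (y (k + 1)) + (g (k + 1) - G (y (k + 1)))‖ ^ 2 := by
        simp only [norm_smul, Real.norm_eq_abs, mul_pow, sq_abs, neg_sq]
        ring
    _ ≤ 2 * (2 * s) ^ 2 * ‖z (k + 1) - y (k + 1)‖ ^ 2
        + 2 * (η * tSeq s τ (k + 1)) ^ 2 * (2 * ‖G (y (k + 1))‖ ^ 2
          + 2 * ‖g (k + 1) - G (y (k + 1))‖ ^ 2) := by
        gcongr
    _ ≤ _ := by
        have e1 : 0 ≤ 4 * η ^ 2 * ‖z (k + 1) - y (k + 1)‖ ^ 2 := by positivity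
        have e2 : 0 ≤ 2 * (2 * s) ^ 2 * (tSeq s τ (k + 1) ^ 2 * ‖G (y (k + 1))‖ ^ 2
          + tSeq s τ (k + 1) ^ 2 * ‖g (k + 1) - G (y (k + 1))‖ ^ 2) := by positivity
        linarith

theorem weight_le (H : ControlledRun G β s γ η τ g x y z) (k : ℕ) :
    ((k + 1 : ℕ) : ℝ) + τ ≤ tSeq s τ k := by
  simp only [tSeq]
  push_cast
  linarith [H.one_lt_s]

theorem weight_le' (H : ControlledRun G β s γ η τ g x y z) (k : ℕ) :
    (k : ℝ) + τ ≤ tSeq s τ k := by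
  simp only [tSeq]
  linarith [H.one_lt_s]

/-- The rates of convergence of the residuals and of the increments. -/
theorem rates (H : ControlledRun G β s γ η τ g x y z) (hne : (zer G).Nonempty) :
    (Summable fun k : ℕ => ((k : ℝ) + τ) * ‖G (y k)‖ ^ 2) ∧
    (Summable fun k : ℕ => ((k : ℝ) + τ) * ‖x (k + 1) - x k‖ ^ 2) ∧
    Tendsto (fun k : ℕ => ((k : ℝ) + τ) ^ 2 * ‖G (y k)‖ ^ 2) atTop (𝓝 0) ∧
    Tendsto (fun k : ℕ => ((k : ℝ) + τ) ^ 2 * ‖x (k + 1) - x k‖ ^ 2) atTop (𝓝 0) := by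
  obtain ⟨p, hp⟩ := id hne
  have h1 := (H.energy_summable hp).1
  obtain ⟨h4, h4'⟩ := H.sub_tendsto_zero hne
  have h5 := H.summable_error
  have h6 := (H.residual_tendsto hne).1
  obtain ⟨C, hC, hx⟩ := H.exists_sq_increment_le
  have ht1 : ∀ k, 1 ≤ tSeq s τ k := fun k => by
    linarith [le_tSeq s H.one_le_tau k, H.one_lt_s]
  refine ⟨?_, ?_, ?_, ?_⟩
  · refine h1.of_nonneg_of_le (fun k => by positivity) fun k => ?_
    have := H.weight_le' k
    gcongr
  -- The first increment involves the arbitrary `x 0` and is dropped.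
  · refine (summable_nat_add_iff 1).1 ?_
    have hsum := ((summable_nat_add_iff 1).2 ((h4.add h1).add h5)).mul_left (2 * C)
    refine hsum.of_nonneg_of_le (fun k => by positivity) fun k => ?_
    have ht := H.t_pos k
    have ht' := H.t_pos (k + 1)
    have e1 : ((k + 1 : ℕ) : ℝ) + τ ≤ 2 / tSeq s τ (k + 1) * tSeq s τ k ^ 2 := by
      refine (H.weight_le k).trans ?_
      rw [div_mul_eq_mul_div, le_div_iff₀ ht', tSeq_succ]
      nlinarith [ht1 k]
    have e2 : tSeq s τ (k + 1) * ‖g (k + 1) - G (y (k + 1))‖ ^ 2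
        ≤ tSeq s τ (k + 1) ^ 2 * ‖g (k + 1) - G (y (k + 1))‖ ^ 2 := by
      gcongr
      nlinarith [ht1 (k + 1)]
    calc (((k + 1 : ℕ) : ℝ) + τ) * ‖x (k + 1 + 1) - x (k + 1)‖ ^ 2
        ≤ 2 / tSeq s τ (k + 1) * tSeq s τ k ^ 2 * ‖x (k + 1 + 1) - x (k + 1)‖ ^ 2 := by
          gcongr
      _ = 2 / tSeq s τ (k + 1) * (tSeq s τ k ^ 2 * ‖x (k + 1 + 1) - x (k + 1)‖ ^ 2) := by ring
      _ ≤ 2 / tSeq s τ (k + 1) * _ := mul_le_mul_of_nonneg_left (hx k) (by positivity)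
      _ = 2 * C * (‖z (k + 1) - y (k + 1)‖ ^ 2 / tSeq s τ (k + 1)
          + tSeq s τ (k + 1) * ‖G (y (k + 1))‖ ^ 2
          + tSeq s τ (k + 1) * ‖g (k + 1) - G (y (k + 1))‖ ^ 2) := by
          field_simp
      _ ≤ _ := by gcongr
  · refine squeeze_zero (fun k => by positivity) (fun k => ?_) h6
    have := H.weight_le' k
    gcongr
  · refine (tendsto_add_atTop_iff_nat 1).1 ?_
    have hlim := (tendsto_add_atTop_iff_nat 1).2
      (((h4'.add h6).add h5.tendsto_atTop_zero).const_mul C)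
    rw [add_zero, add_zero, mul_zero] at hlim
    refine squeeze_zero (fun k => by positivity) (fun k => le_trans ?_ (hx k)) hlim
    have := H.weight_le k
    gcongr

/-- The iterates converge to a solution. -/
theorem exists_tendsto_solution [FiniteDimensional ℝ E] (H : ControlledRun G β s γ η τ g x y z)
    (hne : (zer G).Nonempty) :
    ∃ p ∈ zer G, Tendsto x atTop (𝓝 p) ∧ Tendsto y atTop (𝓝 p) ∧ Tendsto z atTop (𝓝 p) := by
  have : ProperSpace E := FiniteDimensional.proper ℝ E
  obtain ⟨p₀, hp₀⟩ := id hne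
  obtain ⟨hres, hdist⟩ := H.residual_tendsto hne
  have hcont : Continuous G :=
    continuous_of_cocoercive (by linarith [H.eta_pos, H.eta_le]) H.cocoercive
  have hzy : Tendsto (fun k => z k - y k) atTop (𝓝 0) := by
    have := (H.sub_tendsto_zero hne).2.sqrt
    simp only [Real.sqrt_sq (norm_nonneg _), Real.sqrt_zero] at this
    exact tendsto_zero_iff_norm_tendsto_zero.2 this
  obtain ⟨l, hl⟩ := hdist p₀ hp₀
  obtain ⟨M, hM⟩ := hl.bddAbove_range
  have hball : ∀ k, z k ∈ Metric.closedBall p₀ (Real.sqrt M) := fun k => by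
    rw [Metric.mem_closedBall, dist_eq_norm]
    exact Real.le_sqrt_of_sq_le (hM ⟨k, rfl⟩)
  obtain ⟨p, -, φ, hφ, hzφ⟩ := tendsto_subseq_of_bounded Metric.isBounded_closedBall hball
  have hyφ : Tendsto (y ∘ φ) atTop (𝓝 p) := by
    have := hzφ.sub (hzy.comp hφ.tendsto_atTop)
    rw [sub_zero] at this
    exact this.congr fun k => by simp
  have hGy : Tendsto (fun k => G (y k)) atTop (𝓝 0) := by
    have hsq : Tendsto (fun k => ‖G (y k)‖ ^ 2) atTop (𝓝 0) := by
      refine squeeze_zero (fun k => sq_nonneg _) (fun k => ?_) hres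
      refine le_mul_of_one_le_left (sq_nonneg _) ?_
      nlinarith [le_tSeq s H.one_le_tau k, H.one_lt_s]
    have := hsq.sqrt
    simp only [Real.sqrt_sq (norm_nonneg _), Real.sqrt_zero] at this
    exact tendsto_zero_iff_norm_tendsto_zero.2 this
  have hp : p ∈ zer G :=
    tendsto_nhds_unique ((hcont.tendsto p).comp hyφ) (hGy.comp hφ.tendsto_atTop)
  obtain ⟨m, hm⟩ := hdist p hp
  -- Opial's argument: the distance to the cluster point `p` converges, and it vanishes along a
  -- subsequence.
  have hm0 : m = 0 := by
    have h1 := hm.comp hφ.tendsto_atTop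
    have h2 : Tendsto (fun k => ‖z (φ k) - p‖ ^ 2) atTop (𝓝 (‖p - p‖ ^ 2)) :=
      ((hzφ.sub_const p).norm).pow 2
    rw [sub_self, norm_zero, zero_pow two_ne_zero] at h2
    exact tendsto_nhds_unique h1 h2
  rw [hm0] at hm
  have hz : Tendsto z atTop (𝓝 p) := by
    have := hm.sqrt
    simp only [Real.sqrt_sq (norm_nonneg _), Real.sqrt_zero] at this
    exact tendsto_iff_norm_sub_tendsto_zero.2 this
  have hy : Tendsto y atTop (𝓝 p) := by
    have := hz.sub hzy
    rw [sub_zero] at this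
    exact this.congr fun k => by simp
  refine ⟨p, hp, ?_, hy, hz⟩
  refine (tendsto_add_atTop_iff_nat 1).1 ?_
  have hz1 := (tendsto_add_atTop_iff_nat 1).2 hz
  have hγ := H.gamma_pos
  have hs := H.one_lt_s
  have hxy : Tendsto (fun k => x (k + 1) - y k) atTop (𝓝 0) := by
    have := (hz1.sub hz).const_smul (s / γ)
    rw [sub_self, smul_zero] at this
    refine this.congr fun k => ?_
    rw [H.z_succ k, add_sub_cancel_left, smul_smul, div_mul_div_cancel₀ hγ.ne',
      div_self (by linarith), one_smul]
  have := hxy.add hy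
  rw [zero_add] at this
  exact this.congr fun k => by simp

end ControlledRun

end Run

/-! ### Arithmetic of the step size and of the weights. -/

section Parameters

variable {s γ η κ β β' Θ Θ' : ℝ} {τ : ℕ}

theorem one_sub_alpha (hs : 1 < s) : 1 - alpha s = s ^ 2 / (s + 1) ^ 2 := by
  have : s + 1 ≠ 0 := by linarith
  rw [alpha]
  field_simp
  ring

theorem alpha_pos (hs : 1 < s) : 0 < alpha s := by
  rw [alpha]
  positivity

theorem alpha_lt_one (hs : 1 < s) : alpha s < 1 := by
  have h1 := one_sub_alpha hs
  have : 0 < s ^ 2 / (s + 1) ^ 2 := by positivity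
  linarith

theorem theta_pos (hs : 1 < s) (hκ : 0 < κ) : 0 < theta κ s := by
  rw [theta]
  nlinarith [alpha_pos hs, alpha_lt_one hs, mul_pos hκ (alpha_pos hs)]

theorem theta_le_one (hs : 1 < s) (hκ1 : κ ≤ 1) : theta κ s ≤ 1 := by
  rw [theta]
  nlinarith [alpha_pos hs]

/-- `α ≥ 3 / (4 s)`, because `4 s (2 s + 1) - 3 (s + 1)² = (s - 1) (5 s + 3)`. -/
theorem inv_kappa_le (hs : 1 < s) (hκ : alpha s < κ) : 1 / κ ≤ 4 / 3 * s := by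
  have h0 := alpha_pos hs
  refine (one_div_le_one_div_of_le h0 hκ.le).trans ?_
  rw [alpha, one_div_div, div_le_iff₀ (by positivity)]
  nlinarith

/-- The weight grows by `2 t + 1 - s`, and `κ / 2` times the old weight has to pay for `1 - κ` times
this growth. The worst case is `κ = α`, where `1 - α = s² / (s + 1)²`. -/
theorem weight_contraction (hs : 1 < s) (hκ : alpha s < κ) {t : ℝ} (ht : 3 * s + 1 ≤ t) :
    (1 - κ) * ((t + 1) * (t + 1 - s)) ≤ (1 - κ / 2) * (t * (t - s)) := by
  have h1 : 1 - κ ≤ s ^ 2 / (s + 1) ^ 2 := by linarith [one_sub_alpha hs]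
  have h2 : (2 * s + 1) / (s + 1) ^ 2 ≤ κ := hκ.le
  have h3 : 0 ≤ 2 * t + 1 - s := by linarith
  have h4 : 0 ≤ t * (t - s) := mul_nonneg (by linarith) (by linarith)
  have h5 : s ^ 2 / (s + 1) ^ 2 * (2 * t + 1 - s)
      ≤ (2 * s + 1) / (s + 1) ^ 2 / 2 * (t * (t - s)) := by
    have : s ^ 2 * (2 * t + 1 - s) ≤ (2 * s + 1) / 2 * (t * (t - s)) := by
      -- Expanded about the smallest admissible `t`, the difference has only positive coefficients.
      obtain ⟨u, hu, rfl⟩ : ∃ u, 0 ≤ u ∧ t = 3 * s + 1 + u := ⟨t - (3 * s + 1), by linarith, by ring⟩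
      have h6 : 0 < s := by linarith
      have h7 : (2 * s + 1) / 2 * ((3 * s + 1 + u) * (3 * s + 1 + u - s))
          - s ^ 2 * (2 * (3 * s + 1 + u) + 1 - s)
          = s ^ 3 + 5 * s ^ 2 + 7 / 2 * s + 1 / 2
            + (3 * s ^ 2 + 9 / 2 * s + 1) * u + (s + 1 / 2) * u ^ 2 := by ring
      have h8 : 0 ≤ s ^ 3 + 5 * s ^ 2 + 7 / 2 * s + 1 / 2
            + (3 * s ^ 2 + 9 / 2 * s + 1) * u + (s + 1 / 2) * u ^ 2 := by positivity
      linarith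
    calc s ^ 2 / (s + 1) ^ 2 * (2 * t + 1 - s) = s ^ 2 * (2 * t + 1 - s) / (s + 1) ^ 2 := by ring
      _ ≤ (2 * s + 1) / 2 * (t * (t - s)) / (s + 1) ^ 2 := by gcongr
      _ = _ := by ring
  have h6 := mul_le_mul_of_nonneg_right h1 h3
  have h7 := mul_le_mul_of_nonneg_right h2 h4
  linarith

/-- The summand `τ` in `t_l` gives `1 + j ≤ τ ≤ t_l - s`, so the shift at most doubles each factor.
-/
theorem weight_window_le (hs : 1 < s) (l j : ℕ) (hj : j < τ) :
    tSeq s τ (l + 1 + j) * (tSeq s τ (l + 1 + j) - s)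
      ≤ 4 * (tSeq s τ l * (tSeq s τ l - s)) := by
  have h1 : (j : ℝ) + 1 ≤ τ := by exact_mod_cast hj
  have h2 : (0 : ℝ) ≤ l := l.cast_nonneg
  have h3 : (0 : ℝ) ≤ j := j.cast_nonneg
  have e : tSeq s τ (l + 1 + j) = tSeq s τ l + (1 + j) := by
    simp only [tSeq]
    push_cast
    ring
  have h4 : 1 + (j : ℝ) ≤ tSeq s τ l - s := by
    simp only [tSeq]
    linarith
  rw [e]
  have h5 : tSeq s τ l + (1 + j) ≤ 2 * tSeq s τ l := by linarith
  have h6 : tSeq s τ l + (1 + j) - s ≤ 2 * (tSeq s τ l - s) := by linarith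
  have := mul_le_mul h5 h6 (by linarith) (by linarith)
  linarith

/-- For `β = 0` the first branch would require `0 < β' ≤ 0`, and the second one is zero. -/
theorem beta_pos_of_etaBar_pos (hβ : 0 ≤ β) (hη : 0 < etaBar β β' Θ Θ' κ s γ τ) : 0 < β := by
  rcases hβ.eq_or_lt with h | h
  · rw [etaBar, ← h, mul_zero, zero_div, mul_zero, zero_div,
      if_neg (fun h => absurd h.1 (not_lt.2 h.2))] at hη
    exact absurd hη (lt_irrefl _)
  · exact h

/-- The two consequences of the step size restriction. -/
theorem step_size_bounds (hs : 1 < s) (hγ1 : γ ≤ 1) (hβ' : 0 ≤ β') (hΘ : 0 ≤ Θ)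
    (hΘ' : 0 ≤ Θ') (hΘ'0 : β' = 0 → Θ' = 0) (hκ : 0 < κ) (hκ1 : κ ≤ 1) (hη : 0 < η)
    (hη' : η ≤ etaBar β β' Θ Θ' κ s γ τ) :
    η * (7 / 3 * s * Θ + (1 + τ)) ≤ β ∧ η * s * Θ' ≤ 3 / 7 * β' := by
  have hθ := theta_pos hs hκ
  have hθ1 := theta_le_one hs hκ1
  have hΛ : s ≤ lam s γ := by
    rw [lam]
    linarith
  have hΛ0 : 0 < lam s γ := by linarith
  obtain ⟨M, hM⟩ : ∃ M, M = 7 * lam s γ * Θ + 3 * theta κ s * (1 + (τ : ℝ)) := ⟨_, rfl⟩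
  have hM0 : 0 < M := by
    rw [hM]
    positivity
  rw [etaBar, ← hM] at hη'
  -- For `β', Θ' > 0` the threshold on `β'` is where the two quotients agree, so `etaBar` is the
  -- smaller of them and both bounds hold in either branch.
  have key : η * M ≤ 3 * theta κ s * β ∧ η * (7 * lam s γ * Θ') ≤ 3 * theta κ s * β' := by
    split_ifs at hη' with h
    · obtain ⟨h1, h2⟩ := h
      have hΘ'pos : 0 < Θ' := by
        refine hΘ'.lt_of_ne fun h0 => ?_
        rw [← h0, mul_zero, zero_mul, zero_div] at h2
        linarith
      have h3 : 0 < 7 * lam s γ * Θ' := by positivity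
      rw [le_div_iff₀ h3] at hη'
      rw [le_div_iff₀ hM0] at h2
      refine ⟨?_, hη'⟩
      have h4 := mul_le_mul_of_nonneg_right hη' hM0.le
      have h5 := mul_le_mul_of_nonneg_left h2 (show 0 ≤ 3 * theta κ s by positivity)
      refine le_of_mul_le_mul_right ?_ h3
      linarith
    · have hη'' := (le_div_iff₀ hM0).1 hη'
      refine ⟨hη'', ?_⟩
      rcases hβ'.eq_or_lt with h0 | h0
      · rw [hΘ'0 h0.symm, ← h0]
        simp
      · have h1 : 7 * lam s γ * Θ' * β / M < β' := by
          by_contra hcon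
          exact h ⟨h0, not_lt.1 hcon⟩
        rw [div_lt_iff₀ hM0] at h1
        have h4 := mul_le_mul_of_nonneg_right hη'' (show 0 ≤ 7 * lam s γ * Θ' by positivity)
        have h5 := mul_le_mul_of_nonneg_left h1.le (show 0 ≤ 3 * theta κ s by positivity)
        refine le_of_mul_le_mul_right ?_ hM0
        linarith
  obtain ⟨k1, k2⟩ := key
  constructor
  · have h1 : theta κ s * (7 * s * Θ) ≤ 7 * lam s γ * Θ := by
      calc theta κ s * (7 * s * Θ) ≤ 1 * (7 * lam s γ * Θ) := by gcongr
        _ = _ := one_mul _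
    have h2 := mul_le_mul_of_nonneg_left h1 hη.le
    refine le_of_mul_le_mul_left ?_ (show 0 < 3 * theta κ s by positivity)
    rw [hM] at k1
    linarith
  · have h1 : η * (7 * s * Θ') ≤ η * (7 * lam s γ * Θ') := by gcongr
    have h2 : 3 * theta κ s * β' ≤ 3 * 1 * β' := by gcongr
    linarith

end Parameters

/-! ### Closing the loop between energy and errors. -/

section Summation

open Finset in
/-- The energy estimate and the error recursion, both in expectation, make the expected errors
summable with weights. -/
theorem summable_weighted_errors {W t X dd rr ee δ : ℕ → ℝ} {β η κ s Θ q C : ℝ} {τ : ℕ}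
    (hτ : 1 ≤ τ) (hη : 0 < η) (hs : 1 < s) (hκ : 0 < κ) (hκs : 1 / κ ≤ 4 / 3 * s)
    (hΘ : 0 ≤ Θ) (hq : 0 ≤ q) (hηβ : η * (7 / 3 * s * Θ + (1 + τ)) ≤ β) (hηq : η * s * q ≤ 3 / 7)
    (hC : 0 ≤ C) (hW : ∀ k, 0 < W k) (htW : ∀ k, t k ^ 2 ≤ 3 / 2 * W k)
    (ht : Summable fun k => 1 / t k ^ 2) (htop : Tendsto t atTop atTop)
    (hX : ∀ k, 0 ≤ X k) (hdd : ∀ k, 0 ≤ dd k) (hrr : ∀ k, 0 ≤ rr k) (hee : ∀ k, 0 ≤ ee k)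
    (hδ0 : ∀ k, 0 ≤ δ k) (hδ : Summable δ)
    (hstep : ∀ k, X (k + 1) ≤ (1 + C / t k ^ 2) * X k - W k * rr k - W k * β * dd k
      + η / 4 * (1 + 2 * τ) * t k ^ 2 * dd k
      + (η / (8 * τ) + η / (192 * τ)) * t k ^ 2 * ee k + C * ee k)
    (hnoise : ∀ n, ∑ k ∈ range (n + 1), W k * ee k
      ≤ 8 * τ / κ * ∑ k ∈ range n, W k * (Θ * dd k + q * rr k)
        + 2 / κ * ∑ k ∈ range (n + 1), δ k) :
    Summable fun k => W k * ee k := by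
  have hτ' : (1 : ℝ) ≤ τ := by exact_mod_cast hτ
  have hτ0 : (0 : ℝ) < τ := by linarith
  have hs0 : 0 < s := by linarith
  -- An extra `η / (192 τ) t²` absorbs the unweighted `C * ee k` for large `k`; `c` collects the
  -- finitely many excesses.
  set c : ℕ → ℝ := fun k => max (C - η / (192 * τ) * t k ^ 2) 0 * ee k with hc
  have hc0 : ∀ k, 0 ≤ c k := fun k => mul_nonneg (le_max_right _ _) (hee k)
  have hcs : Summable c := by
    have hev : ∀ᶠ k in atTop, c k = 0 := by
      have h2 : Tendsto (fun k => η / (192 * τ) * t k ^ 2) atTop atTop :=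
        ((tendsto_pow_atTop two_ne_zero).comp htop).const_mul_atTop (by positivity)
      filter_upwards [h2.eventually_ge_atTop C] with k hk
      simp only [hc]
      rw [max_eq_right (by linarith), zero_mul]
    exact summable_zero.congr_atTop (hev.mono fun k hk => hk.symm)
  have hβd : 7 / 3 * (η * s * Θ) ≤ β - 3 / 8 * η * (1 + 2 * τ) := by
    have : 0 ≤ η * τ := by positivity
    linarith
  set A : ℕ → ℝ := fun k => W k * (rr k + (β - 3 / 8 * η * (1 + 2 * τ)) * dd k) with hA
  -- The error coefficient is `(1/8 + 1/192 + 1/192) η/τ = 13 η / (96 τ)` before `t²` is replaced by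
  -- `3/2 W`, and `13 η / (64 τ)` after. Times `8 τ / κ ≤ 8 τ · 4 s / 3` this is `13/6 η s`, and
  -- `13/6 · 3/7 = 13/14` leaves `1/14` of the decrement.
  have hσA : ∀ k, 13 / 6 * (η * s) * (W k * (Θ * dd k + q * rr k)) ≤ 13 / 14 * A k := fun k => by
    have h1 := mul_le_mul_of_nonneg_right hβd (hdd k)
    have h2 := mul_le_mul_of_nonneg_right hηq (hrr k)
    have h3 : 13 / 6 * (η * s) * (Θ * dd k + q * rr k)
        ≤ 13 / 14 * (rr k + (β - 3 / 8 * η * (1 + 2 * τ)) * dd k) := by linarith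
    have := mul_le_mul_of_nonneg_left h3 (hW k).le
    simp only [hA]
    linarith
  have hσ0 : ∀ k, 0 ≤ W k * (Θ * dd k + q * rr k) := fun k =>
    mul_nonneg (hW k).le (add_nonneg (mul_nonneg hΘ (hdd k)) (mul_nonneg hq (hrr k)))
  have hA0 : ∀ k, 0 ≤ A k := fun k => by
    have h1 := hσA k
    have := mul_nonneg (show 0 ≤ 13 / 6 * (η * s) by positivity) (hσ0 k)
    linarith
  have hstep' : ∀ k, X (k + 1) ≤ X k + C / t k ^ 2 * X k - A k
      + 13 * η / (64 * τ) * (W k * ee k) + c k := fun k => by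
    have h1 : C * ee k ≤ η / (192 * τ) * t k ^ 2 * ee k + c k := by
      have := mul_le_mul_of_nonneg_right
        (le_max_left (C - η / (192 * τ) * t k ^ 2) 0) (hee k)
      simp only [hc]
      linarith
    have h2 : η / 4 * (1 + 2 * τ) * t k ^ 2 * dd k
        ≤ 3 / 8 * η * (1 + 2 * τ) * (W k * dd k) := by
      have := mul_le_mul_of_nonneg_left (htW k)
        (show 0 ≤ η / 4 * (1 + 2 * τ) * dd k from mul_nonneg (by positivity) (hdd k))
      linarith
    have h3 : 13 * η / (96 * τ) * (t k ^ 2 * ee k) ≤ 13 * η / (64 * τ) * (W k * ee k) := by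
      have := mul_le_mul_of_nonneg_left (htW k)
        (show 0 ≤ 13 * η / (96 * τ) * ee k from mul_nonneg (by positivity) (hee k))
      calc 13 * η / (96 * τ) * (t k ^ 2 * ee k) = 13 * η / (96 * τ) * ee k * t k ^ 2 := by ring
        _ ≤ _ := this
        _ = _ := by
          field_simp
          ring
    have h4 : 13 * η / (96 * τ) * (t k ^ 2 * ee k)
        = (η / (8 * τ) + η / (192 * τ)) * t k ^ 2 * ee k + η / (192 * τ) * t k ^ 2 * ee k := by
      field_simp
      ring
    have h5 := hstep k
    simp only [hA]
    linarith
  obtain ⟨Δs, hΔs⟩ : ∃ Δs, Δs = 2 / κ * ∑' k, δ k := ⟨_, rfl⟩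
  have hΔ0 : 0 ≤ Δs := by
    rw [hΔs]
    exact mul_nonneg (by positivity) (tsum_nonneg hδ0)
  have hee0 : ∀ k, 0 ≤ W k * ee k := fun k => mul_nonneg (hW k).le (hee k)
  have hnoise' : ∀ n, ∑ k ∈ range n, W k * ee k
      ≤ 8 * τ / κ * ∑ k ∈ range n, W k * (Θ * dd k + q * rr k) + Δs := fun n => by
    have h1 := hnoise n
    rw [sum_range_succ] at h1
    have h2 := mul_le_mul_of_nonneg_left (hδ.sum_le_tsum (range (n + 1)) (fun i _ => hδ0 i))
      (show 0 ≤ 2 / κ by positivity)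
    rw [hΔs]
    linarith [hee0 n]
  have hB : ∀ n, 13 * η / (64 * τ) * ∑ k ∈ range n, W k * ee k
      ≤ 13 / 14 * ∑ k ∈ range n, A k + 13 * η / (64 * τ) * Δs := fun n => by
    have h1 := mul_le_mul_of_nonneg_left (hnoise' n) (show 0 ≤ 13 * η / (64 * τ) by positivity)
    have h2 : 0 ≤ ∑ k ∈ range n, W k * (Θ * dd k + q * rr k) := sum_nonneg fun k _ => hσ0 k
    have h3 : 13 * η / (64 * τ) * (8 * τ / κ * ∑ k ∈ range n, W k * (Θ * dd k + q * rr k))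
        ≤ 13 / 6 * (η * s) * ∑ k ∈ range n, W k * (Θ * dd k + q * rr k) := by
      rw [← mul_assoc]
      refine mul_le_mul_of_nonneg_right ?_ h2
      have h4 := mul_le_mul_of_nonneg_left hκs (show 0 ≤ 13 / 8 * η by positivity)
      calc 13 * η / (64 * τ) * (8 * τ / κ) = 13 / 8 * η * (1 / κ) := by
            field_simp
            ring
        _ ≤ _ := h4
        _ = _ := by ring
    have h5 : 13 / 6 * (η * s) * ∑ k ∈ range n, W k * (Θ * dd k + q * rr k)
        ≤ 13 / 14 * ∑ k ∈ range n, A k := by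
      rw [mul_sum, mul_sum]
      exact sum_le_sum fun k _ => hσA k
    linarith
  have hsum : ∀ n, X n + ∑ k ∈ range n, A k ≤ X 0 + ∑ k ∈ range n, C / t k ^ 2 * X k
      + 13 * η / (64 * τ) * ∑ k ∈ range n, W k * ee k + ∑ k ∈ range n, c k := fun n => by
    induction n with
    | zero => simp
    | succ n ih =>
      simp only [sum_range_succ, mul_add]
      linarith [hstep' n]
  obtain ⟨K, hK⟩ : ∃ K, K = X 0 + 13 * η / (64 * τ) * Δs + ∑' k, c k := ⟨_, rfl⟩
  have hK0 : 0 ≤ K := by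
    rw [hK]
    have := hX 0
    have : 0 ≤ ∑' k, c k := tsum_nonneg hc0
    positivity
  have hfin : ∀ n, X n + 1 / 14 * ∑ k ∈ range n, A k
      ≤ K + ∑ k ∈ range n, C / t k ^ 2 * X k := fun n => by
    have h1 := hsum n
    have h2 := hB n
    have h3 := hcs.sum_le_tsum (range n) (fun i _ => hc0 i)
    rw [hK]
    linarith
  have ha : Summable fun k => C / t k ^ 2 := by
    simpa [div_eq_mul_inv] using ht.mul_left C
  have hXb := le_mul_exp_tsum_of_le_add_sum hK0 (fun k => by positivity) ha (fun n => by
    have h1 := hfin n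
    have h2 : 0 ≤ ∑ k ∈ range n, A k := sum_nonneg fun k _ => hA0 k
    linarith)
  have haX : Summable fun k => C / t k ^ 2 * X k :=
    (ha.mul_right _).of_nonneg_of_le (fun k => mul_nonneg (by positivity) (hX k))
      (fun k => mul_le_mul_of_nonneg_left (hXb k) (by positivity))
  refine summable_of_sum_range_le hee0 (c := 64 * τ / (13 * η) *
    (13 / 14 * (14 * (K + ∑' k, C / t k ^ 2 * X k)) + 13 * η / (64 * τ) * Δs)) fun n => ?_
  have h1 := hfin n
  have h2 := haX.sum_le_tsum (range n) (fun i _ => mul_nonneg (by positivity) (hX i))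
  have h3 := hX n
  have h4 : 13 * η / (64 * τ) * ∑ k ∈ range n, W k * ee k
      ≤ 13 / 14 * (14 * (K + ∑' k, C / t k ^ 2 * X k)) + 13 * η / (64 * τ) * Δs := by
    have := hB n
    linarith
  have h5 := mul_le_mul_of_nonneg_left h4 (show 0 ≤ 64 * τ / (13 * η) by positivity)
  refine le_trans (le_of_eq ?_) h5
  field_simp

end Summation

/-! ### Integrability and almost sure summability. -/

section Integrals

variable {Ω : Type*} {mΩ : MeasurableSpace Ω} {P : Measure Ω}

theorem integrable_and_integral_le_of_lintegral_le {X R : Ω → ℝ} (hX : AEStronglyMeasurable X P)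
    (hX0 : ∀ ω, 0 ≤ X ω) (hR : Integrable R P) (hR0 : ∀ ω, 0 ≤ R ω)
    (h : ∫⁻ ω, ENNReal.ofReal (X ω) ∂P ≤ ∫⁻ ω, ENNReal.ofReal (R ω) ∂P) :
    Integrable X P ∧ ∫ ω, X ω ∂P ≤ ∫ ω, R ω ∂P := by
  have hRfin : ∫⁻ ω, ENNReal.ofReal (R ω) ∂P ≠ ∞ := by
    rw [← ofReal_integral_eq_lintegral_ofReal hR (ae_of_all _ hR0)]
    exact ENNReal.ofReal_ne_top
  refine ⟨?_, ?_⟩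
  · exact (lintegral_ofReal_ne_top_iff_integrable hX (ae_of_all _ hX0)).1 (ne_top_of_le_ne_top hRfin h)
  · rw [integral_eq_lintegral_of_nonneg_ae (ae_of_all _ hX0) hX,
      integral_eq_lintegral_of_nonneg_ae (ae_of_all _ hR0) hR.1]
    exact ENNReal.toReal_mono hRfin h

/-- Nonnegative functions with summable integrals are almost surely summable. -/
theorem ae_summable_of_summable_integral {f : ℕ → Ω → ℝ} (hf : ∀ k, Integrable (f k) P)
    (hf0 : ∀ k ω, 0 ≤ f k ω) (hs : Summable fun k => ∫ ω, f k ω ∂P) :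
    ∀ᵐ ω ∂P, Summable fun k => f k ω := by
  have h1 : ∫⁻ ω, ∑' k, ENNReal.ofReal (f k ω) ∂P ≠ ∞ := by
    rw [lintegral_tsum fun k => (hf k).1.aemeasurable.ennreal_ofReal]
    simp_rw [← ofReal_integral_eq_lintegral_ofReal (hf _) (ae_of_all _ (hf0 _))]
    exact hs.tsum_ofReal_ne_top
  have h2 := ae_lt_top' (AEMeasurable.tsum
    fun k => (hf k).1.aemeasurable.ennreal_ofReal) h1
  filter_upwards [h2] with ω hω
  refine (ENNReal.summable_toReal hω.ne).congr fun k => ?_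
  rw [ENNReal.toReal_ofReal (hf0 k ω)]

theorem integrable_sq_norm {E : Type*} [NormedAddCommGroup E] {u : Ω → E} (hu : MemLp u 2 P) : Integrable (fun ω => ‖u ω‖ ^ 2) P :=
  (memLp_two_iff_integrable_sq_norm hu.1).1 hu

theorem integrable_inner_of_memLp {E : Type*} [NormedAddCommGroup E] [InnerProductSpace ℝ E]
    {u v : Ω → E} (hu : MemLp u 2 P) (hv : MemLp v 2 P) :
    Integrable (fun ω => (inner ℝ (u ω) (v ω) : ℝ)) P := by
  refine (((integrable_sq_norm hu).add (integrable_sq_norm hv)).div_const 2).mono' (hu.1.inner hv.1) (ae_of_all _ fun ω => ?_)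
  simpa using abs_inner_le_young (u ω) (v ω) one_pos

end Integrals

/-! ### Measurability of the iterates. -/

section Measurability

variable {E : Type*} [NormedAddCommGroup E] [InnerProductSpace ℝ E] [FiniteDimensional ℝ E]
  [MeasurableSpace E] [BorelSpace E] {Ω : Type*} {mΩ : MeasurableSpace Ω}

theorem measurable_iterates {s : ℝ} {t γ η : ℕ → ℝ} {y0 : E} {g x y z : ℕ → Ω → E}
    (hx : ∀ k, Measurable (x k))
    (h : ∀ ω, IsTrajectory s t γ η y0 (fun k => g k ω) (fun k => x k ω) (fun k => y k ω)
      (fun k => z k ω)) (k : ℕ) : Measurable (y k) ∧ Measurable (z k) := by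
  have : ProperSpace E := FiniteDimensional.proper ℝ E
  induction k with
  | zero =>
    have hy : y 0 = fun _ => y0 := funext fun ω => (h ω).y_zero
    have hz : z 0 = fun _ => y0 := funext fun ω => (h ω).z_zero
    rw [hy, hz]
    exact ⟨measurable_const, measurable_const⟩
  | succ k ih =>
    have hz' : z (k + 1) = fun ω => z k ω + (γ k / s) • (x (k + 1) ω - y k ω) :=
      funext fun ω => (h ω).z_succ k
    have hy' : y (k + 1) = fun ω => ((t k - s) / t k) • x (k + 1) ω + (s / t k) • z (k + 1) ω :=
      funext fun ω => (h ω).y_succ k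
    have hzm : Measurable (z (k + 1)) := by
      rw [hz']
      exact ih.2.add (((hx (k + 1)).sub ih.1).const_smul _)
    refine ⟨?_, hzm⟩
    rw [hy']
    exact ((hx (k + 1)).const_smul _).add (hzm.const_smul _)

/-- The estimator is recovered from `y k - x (k + 1)` by dividing by the nonzero step. -/
theorem measurable_estimator {s : ℝ} {t γ η : ℕ → ℝ} {y0 : E} {g x y z : ℕ → Ω → E}
    (hx : ∀ k, Measurable (x k)) (hη : ∀ k, η k ≠ 0)
    (h : ∀ ω, IsTrajectory s t γ η y0 (fun k => g k ω) (fun k => x k ω) (fun k => y k ω)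
      (fun k => z k ω)) (k : ℕ) : Measurable (g k) := by
  have : ProperSpace E := FiniteDimensional.proper ℝ E
  have hg : g k = fun ω => (η k)⁻¹ • (y k ω - x (k + 1) ω) := by
    funext ω
    have := (h ω).x_succ k
    rw [this, sub_sub_cancel, inv_smul_smul₀ (hη k)]
  rw [hg]
  exact ((measurable_iterates hx h k).1.sub (hx (k + 1))).const_smul _

end Measurability

/-! ### Measurable bounds for the perturbations. -/

section Errors

variable {E : Type*} [NormedAddCommGroup E] [InnerProductSpace ℝ E]

/-- The surplus in the co-coercivity inequality. -/
noncomputable def surplus (G : E → E) (β : ℝ) (u v : E) : ℝ :=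
  inner ℝ (G u - G v) (u - v) - β * ‖G u - G v‖ ^ 2

/-- A measurable bound for the perturbation in the error recursion. -/
noncomputable def perturbation (G : E → E) (β q Θ : ℝ) (u v : E) : ℝ :=
  Θ * ‖G u - G v‖ ^ 2 + q * surplus G β u v

theorem surplus_nonneg {G : E → E} {β β' : ℝ} {D : E → E → ℝ} (hG : GenCocoercive G β β' D)
    (u v : E) : 0 ≤ surplus G β u v := by
  rw [surplus]
  have h1 := hG.ineq u v
  have h2 := mul_nonneg hG.beta'_nonneg (hG.D_nonneg u v)
  linarith

theorem perturbation_nonneg {G : E → E} {β β' q Θ : ℝ} {D : E → E → ℝ}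
    (hG : GenCocoercive G β β' D) (hq : 0 ≤ q) (hΘ : 0 ≤ Θ) (u v : E) :
    0 ≤ perturbation G β q Θ u v := by
  rw [perturbation]
  have := surplus_nonneg hG u v
  positivity

theorem perturbation_self (G : E → E) (β q Θ : ℝ) (u : E) : perturbation G β q Θ u u = 0 := by
  simp [perturbation, surplus]

/-- Trades `D`, which need not be measurable, for the surplus, which dominates `β' D`. If `β' = 0`,
then `Θ' = 0` and the quotient `Θ' / β'` is zero by convention. -/
theorem le_perturbation {G : E → E} {β β' Θ Θ' : ℝ} {D : E → E → ℝ}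
    (hG : GenCocoercive G β β' D) (hΘ' : 0 ≤ Θ') (hΘ'0 : β' = 0 → Θ' = 0) (u v : E) :
    Θ * ‖G u - G v‖ ^ 2 + Θ' * D u v ≤ perturbation G β (Θ' / β') Θ u v := by
  rw [perturbation, surplus]
  have h1 := hG.ineq u v
  rcases hG.beta'_nonneg.eq_or_lt with h | h
  · rw [hΘ'0 h.symm]
    simp
  · have h2 : Θ' * D u v = Θ' / β' * (β' * D u v) := by field_simp
    have h3 := mul_le_mul_of_nonneg_left
      (show β' * D u v ≤ inner ℝ (G u - G v) (u - v) - β * ‖G u - G v‖ ^ 2 by linarith)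
      (show 0 ≤ Θ' / β' by positivity)
    linarith

theorem cocoercive_of_genCocoercive {G : E → E} {β β' : ℝ} {D : E → E → ℝ}
    (hG : GenCocoercive G β β' D) (u v : E) :
    β * ‖G u - G v‖ ^ 2 ≤ inner ℝ (G u - G v) (u - v) := by
  have := surplus_nonneg hG u v
  rw [surplus] at this
  linarith

variable {Ω : Type*} {mΩ : MeasurableSpace Ω} {P : Measure Ω}

theorem integrable_surplus {G : E → E} {β : ℝ} {u v : Ω → E} (hu : MemLp u 2 P)
    (hv : MemLp v 2 P) (hGu : MemLp (fun ω => G (u ω)) 2 P) (hGv : MemLp (fun ω => G (v ω)) 2 P) :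
    Integrable (fun ω => surplus G β (u ω) (v ω)) P :=
  (integrable_inner_of_memLp (hGu.sub hGv) (hu.sub hv)).sub
    ((integrable_sq_norm (hGu.sub hGv)).const_mul β)

theorem integrable_energy {s γ η a : ℝ} [IsFiniteMeasure P] {p : E} {w y z : Ω → E}
    (hw : MemLp w 2 P) (hy : MemLp y 2 P) (hz : MemLp z 2 P) :
    Integrable (fun ω => energy s γ η a p (w ω) (y ω) (z ω)) P :=
  (((integrable_sq_norm hw).const_mul _).sub
    ((integrable_inner_of_memLp hw (hz.sub hy)).const_mul _)).add
    ((integrable_sq_norm (hz.sub (memLp_const p))).const_mul _)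

/-- For a zero `p`, `‖G u‖ ≤ ‖u - p‖ / β`. -/
theorem memLp_comp_cocoercive [SecondCountableTopology E] [MeasurableSpace E] [BorelSpace E]
    [IsFiniteMeasure P] {G : E → E} {β : ℝ} (hβ : 0 < β)
    (hG : ∀ u v, β * ‖G u - G v‖ ^ 2 ≤ inner ℝ (G u - G v) (u - v)) (hne : (zer G).Nonempty)
    {u : Ω → E} (hu : MemLp u 2 P) (hum : Measurable u) : MemLp (fun ω => G (u ω)) 2 P := by
  obtain ⟨p, hp⟩ := hne
  refine (hu.sub (memLp_const p)).of_le_mul (c := β⁻¹)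
    ((continuous_of_cocoercive hβ hG).measurable.comp hum).aestronglyMeasurable
    (ae_of_all _ fun ω => ?_)
  have h1 := mul_norm_sub_le_of_cocoercive hG (u ω) p
  rw [show G p = 0 from hp, sub_zero] at h1
  rw [inv_mul_eq_div, le_div_iff₀ hβ, mul_comm]
  exact h1

end Errors

/-! ### The errors in expectation and almost surely. -/

section Main

variable {E : Type*} [NormedAddCommGroup E] [InnerProductSpace ℝ E] [FiniteDimensional ℝ E]
  [MeasurableSpace E] [BorelSpace E]
  {Ω : Type*} {mΩ : MeasurableSpace Ω} {P : Measure Ω} [IsProbabilityMeasure P]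
  {ℱ : Filtration ℕ mΩ} {G : E → E} {β β' : ℝ} {D : E → E → ℝ}
  {s κ Θ Θ' : ℝ} {τ : ℕ} {t : ℕ → ℝ} {g y : ℕ → Ω → E} {d : ℕ → Ω → ℕ} {Δ : ℕ → Ω → ℝ}
  {δ : ℕ → ℝ}

open Finset in
/-- The error condition in expectation, once the iterates up to time `k` are square integrable. -/
theorem error_expectation (hG : GenCocoercive G β β' D) (hβ : 0 < β) (hne : (zer G).Nonempty)
    (herr : ErrorCondition P ℱ G D β β' s t τ g y κ Θ Θ' d Δ δ)
    (hW : ∀ k, 0 < t k * (t k - s)) (hym : ∀ k, Measurable (y k)) (hgm : ∀ k, Measurable (g k))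
    {k : ℕ} (hy : ∀ j ≤ k, MemLp (y j) 2 P) (hΔ : Integrable (prev Δ k) P) :
    MemLp (fun ω => g k ω - G (y k ω)) 2 P ∧ Integrable (Δ k) P ∧
      ∫ ω, ‖g k ω - G (y k ω)‖ ^ 2 ∂P ≤ ∫ ω, Δ k ω ∂P ∧
      ∫ ω, Δ k ω ∂P ≤ (1 - κ) * ∫ ω, prev Δ k ω ∂P
        + ∑ l ∈ Icc (k + 1 - τ) k,
            ∫ ω, perturbation G β (Θ' / β') Θ (y l ω) (y (l - 1) ω) ∂P
        + δ k / (t k * (t k - s)) := by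
  have : ProperSpace E := FiniteDimensional.proper ℝ E
  have hco := cocoercive_of_genCocoercive hG
  have hGm : Measurable G := (continuous_of_cocoercive hβ hco).measurable
  have hGy : ∀ j ≤ k, MemLp (fun ω => G (y j ω)) 2 P := fun j hj =>
    memLp_comp_cocoercive hβ hco hne (hy j hj) (hym j)
  have hq : 0 ≤ Θ' / β' := div_nonneg herr.Theta'_nonneg hG.beta'_nonneg
  have hσi : ∀ l ≤ k, Integrable
      (fun ω => perturbation G β (Θ' / β') Θ (y l ω) (y (l - 1) ω)) P := fun l hl =>
    ((integrable_sq_norm ((hGy l hl).sub (hGy (l - 1) (by omega)))).const_mul Θ).add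
      ((integrable_surplus (hy l hl) (hy (l - 1) (by omega)) (hGy l hl)
        (hGy (l - 1) (by omega))).const_mul _)
  have hσ0 : ∀ l ω, 0 ≤ perturbation G β (Θ' / β') Θ (y l ω) (y (l - 1) ω) := fun l ω =>
    perturbation_nonneg hG hq herr.Theta_nonneg _ _
  have hprev0 : ∀ ω, 0 ≤ prev Δ k ω := fun ω => by
    cases k with
    | zero => exact le_rfl
    | succ k => exact herr.Delta_nonneg k ω
  have hκ1 : 0 ≤ 1 - κ := by linarith [herr.kappa_le_one]
  have hδ0 : 0 ≤ δ k / (t k * (t k - s)) := div_nonneg (herr.delta_nonneg k) (hW k).le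
  have hsumi : Integrable (fun ω => ∑ l ∈ Icc (k + 1 - τ) k,
      perturbation G β (Θ' / β') Θ (y l ω) (y (l - 1) ω)) P :=
    integrable_finsetSum _ fun l hl => hσi l (mem_Icc.1 hl).2
  have hRi := ((hΔ.const_mul (1 - κ)).add hsumi).add
    (integrable_const (μ := P) (δ k / (t k * (t k - s))))
  have hR0 : ∀ ω, 0 ≤ (1 - κ) * prev Δ k ω + ∑ l ∈ Icc (k + 1 - τ) k,
      perturbation G β (Θ' / β') Θ (y l ω) (y (l - 1) ω) + δ k / (t k * (t k - s)) := fun ω =>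
    add_nonneg (add_nonneg (mul_nonneg hκ1 (hprev0 ω)) (sum_nonneg fun l _ => hσ0 l ω)) hδ0
  have hRle : ∫⁻ ω, ENNReal.ofReal (Δ k ω) ∂P ≤ ∫⁻ ω, ENNReal.ofReal ((1 - κ) * prev Δ k ω
      + ∑ l ∈ Icc (k + 1 - τ) k, perturbation G β (Θ' / β') Θ (y l ω) (y (l - 1) ω)
      + δ k / (t k * (t k - s))) ∂P := by
    -- In `[0, ∞]` conditioning preserves the integral, so integrability of `Δ k` comes out as a
    -- conclusion.
    rw [← lintegral_condLExp (ℱ.le k) P]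
    refine lintegral_mono_ae ?_
    filter_upwards [herr.Delta_le k] with ω hω
    refine hω.trans (ENNReal.ofReal_le_ofReal ?_)
    gcongr
    calc ∑ l ∈ Icc (k + 1 - d k ω) k,
          (Θ * ‖G (y l ω) - G (y (l - 1) ω)‖ ^ 2 + Θ' * D (y l ω) (y (l - 1) ω))
        ≤ ∑ l ∈ Icc (k + 1 - d k ω) k, perturbation G β (Θ' / β') Θ (y l ω) (y (l - 1) ω) :=
          sum_le_sum fun l _ => le_perturbation hG herr.Theta'_nonneg herr.Theta'_eq_zero _ _
      _ ≤ _ := by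
          -- The random window is enlarged to the deterministic one of length `τ`.
          refine sum_le_sum_of_subset_of_nonneg (Icc_subset_Icc_left ?_) fun l _ _ => hσ0 l ω
          have := herr.delay_le k ω
          omega
  obtain ⟨hΔi, hΔle⟩ := integrable_and_integral_le_of_lintegral_le
    (herr.Delta_measurable k).aestronglyMeasurable (herr.Delta_nonneg k) hRi hR0 hRle
  have hem : Measurable (fun ω => g k ω - G (y k ω)) := (hgm k).sub (hGm.comp (hym k))
  have hele : ∫⁻ ω, ENNReal.ofReal (‖g k ω - G (y k ω)‖ ^ 2) ∂P
      ≤ ∫⁻ ω, ENNReal.ofReal (Δ k ω) ∂P := by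
    rw [← lintegral_condLExp (ℱ.le k) P fun ω => ENNReal.ofReal (‖g k ω - G (y k ω)‖ ^ 2),
      ← lintegral_condLExp (ℱ.le k) P fun ω => ENNReal.ofReal (Δ k ω)]
    exact lintegral_mono_ae (herr.error_le k)
  obtain ⟨hei, hle⟩ := integrable_and_integral_le_of_lintegral_le
    (hem.norm.pow_const 2).aestronglyMeasurable (fun ω => sq_nonneg _) hΔi (herr.Delta_nonneg k)
    hele
  refine ⟨(memLp_two_iff_integrable_sq_norm hem.aestronglyMeasurable).2 hei, hΔi, hle,
    hΔle.trans (le_of_eq ?_)⟩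
  have e1 : ∫ ω, ((1 - κ) * prev Δ k ω + ∑ l ∈ Icc (k + 1 - τ) k,
      perturbation G β (Θ' / β') Θ (y l ω) (y (l - 1) ω) + δ k / (t k * (t k - s))) ∂P
      = ∫ ω, ((1 - κ) * prev Δ k ω + ∑ l ∈ Icc (k + 1 - τ) k,
        perturbation G β (Θ' / β') Θ (y l ω) (y (l - 1) ω)) ∂P
        + ∫ _, δ k / (t k * (t k - s)) ∂P :=
    integral_add ((hΔ.const_mul (1 - κ)).add hsumi) (integrable_const _)
  have e2 : ∫ ω, ((1 - κ) * prev Δ k ω + ∑ l ∈ Icc (k + 1 - τ) k,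
        perturbation G β (Θ' / β') Θ (y l ω) (y (l - 1) ω)) ∂P
      = ∫ ω, (1 - κ) * prev Δ k ω ∂P + ∫ ω, ∑ l ∈ Icc (k + 1 - τ) k,
        perturbation G β (Θ' / β') Θ (y l ω) (y (l - 1) ω) ∂P :=
    integral_add (hΔ.const_mul (1 - κ)) hsumi
  rw [integral_const_mul, integral_finsetSum _ fun l hl => hσi l (mem_Icc.1 hl).2] at e2
  rw [integral_const, probReal_univ, one_smul, e2] at e1
  exact e1

open Finset in
/-- The estimator errors are almost surely square summable with weights `tₖ²`. -/
theorem ae_summable_errors {γ η : ℝ} {y0 : E} {x z : ℕ → Ω → E}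
    (hne : (zer G).Nonempty) (hG : GenCocoercive G β β' D) (hβ : 0 < β)
    (hs : 1 < s) (hγ : 0 < γ) (hsγ : 1 + 3 * γ ≤ s) (hτ : 1 ≤ τ)
    (hκ : alpha s < κ) (hη : 0 < η) (hηβ : η * (7 / 3 * s * Θ + (1 + τ)) ≤ β)
    (hηβ' : η * s * Θ' ≤ 3 / 7 * β') (hx : ∀ k, Measurable (x k))
    (hxyz : ∀ ω, IsTrajectory s (tSeq s τ) (fun _ => γ) (etaSeq η s τ) y0
      (fun k => g k ω) (fun k => x k ω) (fun k => y k ω) (fun k => z k ω))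
    (herr : ErrorCondition P ℱ G D β β' s (tSeq s τ) τ g y κ Θ Θ' d Δ δ) (hδ : Summable δ) :
    ∀ᵐ ω ∂P, Summable fun k => tSeq s τ k ^ 2 * ‖g k ω - G (y k ω)‖ ^ 2 := by
  have : ProperSpace E := FiniteDimensional.proper ℝ E
  obtain ⟨p, hp⟩ := id hne
  have ht := fun k => le_tSeq s hτ k
  have ht0 : ∀ k, 0 < tSeq s τ k := fun k => by linarith [ht k]
  have hts : ∀ k, 0 < tSeq s τ k - s := fun k => by linarith [ht k]
  have hW : ∀ k, 0 < tSeq s τ k * (tSeq s τ k - s) := fun k => mul_pos (ht0 k) (hts k)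
  have hη0 : ∀ k, etaSeq η s τ k ≠ 0 := fun k => by
    have := ht0 k
    have := hts k
    rw [etaSeq]
    positivity
  have hmeas := measurable_iterates hx hxyz
  have hym := fun k => (hmeas k).1
  have hgm := measurable_estimator hx hη0 hxyz
  have hco := cocoercive_of_genCocoercive hG
  have hexp := fun k => error_expectation hG hβ hne herr hW hym hgm (k := k)
  -- Square integrability propagates by strong induction, since the error at time `k` is bounded
  -- through all `y j` with `j ≤ k` in the window.
  have hLp : ∀ k, MemLp (y k) 2 P ∧ MemLp (z k) 2 P ∧ Integrable (prev Δ k) P := by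
    intro k
    induction k using Nat.strong_induction_on with
    | _ k ih =>
      cases k with
      | zero =>
        have hy : y 0 = fun _ => y0 := funext fun ω => (hxyz ω).y_zero
        have hz : z 0 = fun _ => y0 := funext fun ω => (hxyz ω).z_zero
        rw [hy, hz]
        exact ⟨memLp_const _, memLp_const _, integrable_zero _ _ _⟩
      | succ k =>
        obtain ⟨he, hΔi, -⟩ := hexp k (fun j hj => (ih j (by omega)).1) (ih k (by omega)).2.2
        obtain ⟨hy, hz, -⟩ := ih k (by omega)
        have hg : MemLp (g k) 2 P := by
          refine (he.add (memLp_comp_cocoercive hβ hco hne hy (hym k))).ae_eq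
            (ae_of_all _ fun ω => ?_)
          simp
        have hx' : MemLp (x (k + 1)) 2 P :=
          (hy.sub (hg.const_smul (etaSeq η s τ k))).ae_eq
            (ae_of_all _ fun ω => ((hxyz ω).x_succ k).symm)
        have hz' : MemLp (z (k + 1)) 2 P :=
          (hz.add ((hx'.sub hy).const_smul (γ / s))).ae_eq
            (ae_of_all _ fun ω => ((hxyz ω).z_succ k).symm)
        exact ⟨((hx'.const_smul ((tSeq s τ k - s) / tSeq s τ k)).add
          (hz'.const_smul (s / tSeq s τ k))).ae_eq
            (ae_of_all _ fun ω => ((hxyz ω).y_succ k).symm), hz', hΔi⟩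
  have hy2 := fun k => (hLp k).1
  have hz2 := fun k => (hLp k).2.1
  have hG2 : ∀ k, MemLp (fun ω => G (y k ω)) 2 P := fun k =>
    memLp_comp_cocoercive hβ hco hne (hy2 k) (hym k)
  have hexp' := fun k => hexp k (fun j _ => hy2 j) (hLp k).2.2
  have he2 : ∀ k, Integrable (fun ω => ‖g k ω - G (y k ω)‖ ^ 2) P := fun k =>
    integrable_sq_norm (hexp' k).1
  have hd2 : ∀ k, Integrable (fun ω => ‖G (y (k + 1) ω) - G (y k ω)‖ ^ 2) P := fun k =>
    integrable_sq_norm ((hG2 (k + 1)).sub (hG2 k))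
  have hr1 : ∀ k, Integrable (fun ω => surplus G β (y (k + 1) ω) (y k ω)) P := fun k =>
    integrable_surplus (hy2 _) (hy2 _) (hG2 _) (hG2 _)
  have hL1 : ∀ k, Integrable (fun ω => energy s γ η (tSeq s τ k - 1) p (G (y k ω)) (y k ω)
      (z k ω)) P := fun k => integrable_energy (hG2 k) (hy2 k) (hz2 k)
  have hτ' : (1 : ℝ) ≤ τ := by exact_mod_cast hτ
  have hκ0 : 0 < κ := herr.kappa_pos
  have hq : 0 ≤ Θ' / β' := div_nonneg herr.Theta'_nonneg hG.beta'_nonneg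
  have hηq : η * s * (Θ' / β') ≤ 3 / 7 := by
    rcases hG.beta'_nonneg.eq_or_lt with h | h
    · rw [← h, div_zero, mul_zero]
      norm_num
    · rw [← mul_div_assoc, div_le_iff₀ h]
      exact hηβ'
  have hmono : ∀ u : E, 0 ≤ inner ℝ (G u) (u - p) := fun u => by
    have h1 := hco u p
    rw [show G p = 0 from hp, sub_zero] at h1
    exact le_trans (by positivity) h1
  have htW : ∀ k, tSeq s τ k ^ 2 ≤ 3 / 2 * (tSeq s τ k * (tSeq s τ k - s)) := fun k => by
    nlinarith [ht k, ht0 k]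
  -- Together with `μ = 2 τ` below, the error coefficient is of order `1 / τ` and offsets the factor
  -- `τ` from the delay windows.
  obtain ⟨C, hC, hstep⟩ := exists_energy_succ_le (E := E) (s := s) (γ := γ) (η := η)
    (ε := η / (192 * τ)) hs hγ hsγ hη (by positivity)
  have hX : ∀ k, 0 ≤ ∫ ω, energy s γ η (tSeq s τ k - 1) p (G (y k ω)) (y k ω) (z k ω) ∂P :=
    fun k => integral_nonneg fun ω => le_trans (by positivity)
      (le_energy hs hγ hsγ hη (by linarith [ht k]) (hmono _))
  have hpath : ∀ k ω, energy s γ η (tSeq s τ (k + 1) - 1) p (G (y (k + 1) ω)) (y (k + 1) ω)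
      (z (k + 1) ω) ≤ (1 + C / tSeq s τ k ^ 2)
        * energy s γ η (tSeq s τ k - 1) p (G (y k ω)) (y k ω) (z k ω)
      + (-(tSeq s τ k * (tSeq s τ k - s))) * surplus G β (y (k + 1) ω) (y k ω)
      + (η / 4 * (1 + 2 * τ) * tSeq s τ k ^ 2 - tSeq s τ k * (tSeq s τ k - s) * β)
        * ‖G (y (k + 1) ω) - G (y k ω)‖ ^ 2
      + ((η / (8 * τ) + η / (192 * τ)) * tSeq s τ k ^ 2 + C) * ‖g k ω - G (y k ω)‖ ^ 2 := by
    intro k ω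
    have h1 := hstep (tSeq s τ k) (etaSeq η s τ k) (2 * τ) (G (y k ω)) (G (y (k + 1) ω))
      (g k ω - G (y k ω)) p (y k ω) (z k ω) (x (k + 1) ω) (y (k + 1) ω) (z (k + 1) ω) (ht k)
      (by positivity) rfl (by rw [add_sub_cancel]; exact (hxyz ω).x_succ k) ((hxyz ω).z_succ k)
      ((hxyz ω).y_succ k) (hmono _)
    rw [tSeq_succ, add_sub_cancel_right, surplus]
    have h2 : 0 ≤ s * (s - 1) * inner ℝ (G (y k ω)) (y k ω - p) :=
      mul_nonneg (by nlinarith) (hmono _)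
    have h3 : 0 ≤ η * γ * (tSeq s τ k * ‖G (y k ω)‖ ^ 2) := by
      have := ht0 k
      positivity
    rw [show 4 * (2 * (τ : ℝ)) = 8 * τ by ring] at h1
    linarith
  have hσ0 : ∀ l ω, 0 ≤ perturbation G β (Θ' / β') Θ (y l ω) (y (l - 1) ω) := fun l ω =>
    perturbation_nonneg hG hq herr.Theta_nonneg _ _
  have key : Summable fun k => tSeq s τ k * (tSeq s τ k - s)
      * ∫ ω, ‖g k ω - G (y k ω)‖ ^ 2 ∂P := by
    refine summable_weighted_errors (t := tSeq s τ)
      (X := fun k => ∫ ω, energy s γ η (tSeq s τ k - 1) p (G (y k ω)) (y k ω) (z k ω) ∂P)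
      (dd := fun k => ∫ ω, ‖G (y (k + 1) ω) - G (y k ω)‖ ^ 2 ∂P)
      (rr := fun k => ∫ ω, surplus G β (y (k + 1) ω) (y k ω) ∂P)
      hτ hη hs hκ0 (inv_kappa_le hs hκ) herr.Theta_nonneg hq hηβ hηq hC hW htW
      (summable_inv_tSeq_sq hs τ) ?_ hX
      (fun k => integral_nonneg fun ω => sq_nonneg _)
      (fun k => integral_nonneg fun ω => surplus_nonneg hG _ _)
      (fun k => integral_nonneg fun ω => sq_nonneg _) herr.delta_nonneg hδ ?_ ?_
    · refine tendsto_atTop_mono (fun k => ?_) tendsto_natCast_atTop_atTop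
      simp only [tSeq]
      linarith
    · intro k
      have i1 := (hL1 k).const_mul (1 + C / tSeq s τ k ^ 2)
      have i2 := (hr1 k).const_mul (-(tSeq s τ k * (tSeq s τ k - s)))
      have i3 := (hd2 k).const_mul
        (η / 4 * (1 + 2 * τ) * tSeq s τ k ^ 2 - tSeq s τ k * (tSeq s τ k - s) * β)
      have i4 := (he2 k).const_mul
        ((η / (8 * τ) + η / (192 * τ)) * tSeq s τ k ^ 2 + C)
      have h1 := integral_mono (hL1 (k + 1)) (((i1.add i2).add i3).add i4) (hpath k)
      refine h1.trans (le_of_eq ?_)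
      rw [integral_add' ((i1.add i2).add i3) i4, integral_add' (i1.add i2) i3,
        integral_add' i1 i2, integral_const_mul, integral_const_mul, integral_const_mul,
        integral_const_mul]
      ring
    · intro n
      have hrec := sum_weighted_le_of_delayed_contraction
        (W := fun k => tSeq s τ k * (tSeq s τ k - s)) (D := fun k => ∫ ω, Δ k ω ∂P)
        (σ := fun l => ∫ ω, perturbation G β (Θ' / β') Θ (y l ω) (y (l - 1) ω) ∂P) (δ := δ)
        (τ := τ) hκ0 herr.kappa_le_one hW
        (fun k => integral_nonneg fun ω => herr.Delta_nonneg k ω)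
        (fun l => integral_nonneg fun ω => hσ0 l ω)
        (by simp [perturbation_self])
        (fun k => by
          rw [tSeq_succ]
          exact weight_contraction hs hκ (ht k))
        (fun l j hj => weight_window_le hs l j hj)
        (by simpa [prev] using (hexp' 0).2.2.2)
        (fun k => (hexp' (k + 1)).2.2.2) n
      refine le_trans (sum_le_sum fun k _ => mul_le_mul_of_nonneg_left (hexp' k).2.2.1 (hW k).le)
        (hrec.trans (le_of_eq ?_))
      congr 2
      refine sum_congr rfl fun k _ => ?_
      congr 1
      simp only [perturbation, Nat.add_sub_cancel]
      rw [integral_add ((hd2 k).const_mul _) ((hr1 k).const_mul _), integral_const_mul,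
        integral_const_mul]
  have hae := ae_summable_of_summable_integral
    (f := fun k ω => tSeq s τ k ^ 2 * ‖g k ω - G (y k ω)‖ ^ 2) (P := P)
    (fun k => (he2 k).const_mul _) (fun k ω => by positivity) (by
      simp only [integral_const_mul]
      refine (key.mul_left (3 / 2)).of_nonneg_of_le
        (fun k => mul_nonneg (sq_nonneg _) (integral_nonneg fun ω => sq_nonneg _)) fun k => ?_
      have := mul_le_mul_of_nonneg_right (htW k)
        (integral_nonneg (μ := P) fun ω => sq_nonneg ‖g k ω - G (y k ω)‖)
      linarith)
  exact hae

end Main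

end AFP

/-! ### Assembly. -/

theorem theorem2
    {E : Type*} [NormedAddCommGroup E] [InnerProductSpace ℝ E] [FiniteDimensional ℝ E]
    [MeasurableSpace E] [BorelSpace E]
    {Ω : Type*} {mΩ : MeasurableSpace Ω} (P : Measure Ω) [IsProbabilityMeasure P]
    (ℱ : Filtration ℕ mΩ)
    -- the problem
    (G : E → E) (β β' : ℝ) (D : E → E → ℝ)
    (hzer : (AFP.zer G).Nonempty) (hG : AFP.GenCocoercive G β β' D)
    -- the parameters
    (s γ η κ Θ Θ' : ℝ) (τ : ℕ)
    (hs : 1 < s) (hγ : 0 < γ) (hγ1 : γ ≤ 1) (hsγ : 1 + 3 * γ ≤ s) (hτ : 1 ≤ τ)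
    (hκ : AFP.alpha s < κ) (hΘ : Θ * β' ≤ Θ' * β)
    (hη : 0 < η) (hη' : η ≤ AFP.etaBar β β' Θ Θ' κ s γ τ)
    -- the iterates
    (y0 : E) (g x y z : ℕ → Ω → E)
    (hx : Adapted ℱ x)
    (hxyz : ∀ ω, AFP.IsTrajectory s (AFP.tSeq s τ) (fun _ => γ) (AFP.etaSeq η s τ) y0
      (fun k => g k ω) (fun k => x k ω) (fun k => y k ω) (fun k => z k ω))
    -- the error approximation condition
    (d : ℕ → Ω → ℕ) (Δ : ℕ → Ω → ℝ) (δ : ℕ → ℝ)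
    (herr : AFP.ErrorCondition P ℱ G D β β' s (AFP.tSeq s τ) τ g y κ Θ Θ' d Δ δ)
    (hδ : Summable δ) :
    (∀ᵐ ω ∂P, Summable (fun k : ℕ => ((k : ℝ) + τ) * ‖G (y k ω)‖ ^ 2)) ∧
    (∀ᵐ ω ∂P, Summable (fun k : ℕ => ((k : ℝ) + τ) * ‖x (k + 1) ω - x k ω‖ ^ 2)) ∧
    (∀ᵐ ω ∂P, Tendsto (fun k : ℕ => ((k : ℝ) + τ) ^ 2 * ‖G (y k ω)‖ ^ 2) atTop (𝓝 0)) ∧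
    (∀ᵐ ω ∂P,
      Tendsto (fun k : ℕ => ((k : ℝ) + τ) ^ 2 * ‖x (k + 1) ω - x k ω‖ ^ 2) atTop (𝓝 0)) ∧
    ∃ xstar : Ω → E, Measurable xstar ∧ (∀ ω, xstar ω ∈ AFP.zer G) ∧
      ∀ᵐ ω ∂P,
        Tendsto (fun k => x k ω) atTop (𝓝 (xstar ω)) ∧
        Tendsto (fun k => y k ω) atTop (𝓝 (xstar ω)) ∧
        Tendsto (fun k => z k ω) atTop (𝓝 (xstar ω)) := by
  have hxm : ∀ k, Measurable (x k) := fun k => (hx k).mono (ℱ.le k) le_rfl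
  have hβ : 0 < β := AFP.beta_pos_of_etaBar_pos hG.beta_nonneg (hη.trans_le hη')
  obtain ⟨hηβ, hηβ'⟩ := AFP.step_size_bounds hs hγ1 hG.beta'_nonneg herr.Theta_nonneg
    herr.Theta'_nonneg herr.Theta'_eq_zero herr.kappa_pos herr.kappa_le_one hη hη'
  have hrun : ∀ᵐ ω ∂P, AFP.ControlledRun G β s γ η τ (fun k => g k ω) (fun k => x k ω)
      (fun k => y k ω) (fun k => z k ω) := by
    filter_upwards [AFP.ae_summable_errors hzer hG hβ hs hγ hsγ hτ hκ hη hηβ hηβ' hxm hxyz herr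
      hδ] with ω hω
    refine ⟨hs, hγ, hsγ, hτ, hη, ?_, AFP.cocoercive_of_genCocoercive hG, (hxyz ω).x_succ,
      (hxyz ω).z_succ, (hxyz ω).y_succ, hω⟩
    have h1 : (1 : ℝ) ≤ τ := by exact_mod_cast hτ
    have h2 : 0 ≤ 7 / 3 * s * Θ := mul_nonneg (by positivity) herr.Theta_nonneg
    have h3 := mul_le_mul_of_nonneg_left (show 2 ≤ 7 / 3 * s * Θ + (1 + τ) by linarith) hη.le
    linarith
  refine ⟨hrun.mono fun ω H => (H.rates hzer).1, hrun.mono fun ω H => (H.rates hzer).2.1,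
    hrun.mono fun ω H => (H.rates hzer).2.2.1, hrun.mono fun ω H => (H.rates hzer).2.2.2, ?_⟩
  have hlim := hrun.mono fun ω H => H.exists_tendsto_solution hzer
  obtain ⟨f, hf, hxf⟩ := measurable_limit_of_tendsto_metrizable_ae (L := atTop)
    (fun k => (hxm k).aemeasurable) (hlim.mono fun ω ⟨p, _, hp, _⟩ => ⟨p, hp⟩)
  obtain ⟨p₀, hp₀⟩ := hzer
  have hGc : Continuous G :=
    AFP.continuous_of_cocoercive hβ (AFP.cocoercive_of_genCocoercive hG)
  have hmeas : MeasurableSet {ω | f ω ∈ AFP.zer G} :=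
    hf (isClosed_singleton.preimage hGc).measurableSet
  classical
  -- The measurable limit `f` is known to be a zero only almost surely; elsewhere it is replaced by
  -- the fixed zero `p₀`.
  refine ⟨fun ω => if f ω ∈ AFP.zer G then f ω else p₀, hf.ite hmeas measurable_const,
    fun ω => ?_, ?_⟩
  · beta_reduce
    split_ifs with h
    exacts [h, hp₀]
  · filter_upwards [hlim, hxf] with ω ⟨p, hp, hx1, hy1, hz1⟩ hx2
    rw [tendsto_nhds_unique hx2 hx1, if_pos hp]
    exact ⟨hx1, hy1, hz1⟩
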